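/- Let $F$ be a field of characteristic zero. Let $Y^{+}=\{y_i^{+}\}$, $Y^{-}=\{y_i^{-}\}$, $Z^{+}=\{z_i^{+}\}$, $Z^{-}=\{z_i^{-}\}$ ($i\in\mathbb N$) be disjoint countably infinite sets, $Y=Y^+\cup Y^-$, $Z=Z^+\cup Z^-$, and let $F\langle Y\cup Z,\ast\rangle$ be the free unital associative algebra on $Y\cup Z$, with the $\mathbb Z_2$-grading in which the indeterminates in $Y$ have degree $0$ and those in $Z$ have degree $1$, and the (graded) involution $\ast$ for which the indeterminates in $Y^+\cup Z^+$ are symmetric and those in $Y^-\cup Z^-$ are skew-symmetric. A $T_{\mathbb Z_2,\ast}$-ideal is a two-sided ideal of this algebra that is invariant under $\ast$ and under all algebra endomorphisms that preserve the grading and commute with $\ast$. Let $\mathcal U=UT_3(F)$ be the algebra of upper triangular $3\times 3$ matrices with the elementary $\mathbb Z_2$-grading induced by $(g_1,g_2,g_3)=(0,1,0)$ (the matrix unit $e_{ij}$ has degree $g_i-g_j$) and the reflection involution $e_{ij}^{\ast}=e_{4-j,4-i}$. A polynomial in $F\langle Y\cup Z,\ast\rangle$ is a $(\mathbb Z_2,\ast)$-identity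 of $\mathcal U$ if it vanishes whenever the indeterminates in $Y^+$, $Y^-$, $Z^+$, $Z^-$ are replaced by, respectively, symmetric elements of $\mathcal U_0$, skew-symmetric elements of $\mathcal U_0$, symmetric elements of $\mathcal U_1$, skew-symmetric elements of $\mathcal U_1$. Write $[a,b]=ab-ba$; below, $z_i$ denotes an indeterminate of either $Z^+$ or $Z^-$ (chosen independently for each $i$), and $x_i$, where not restricted, an indeterminate of any of the four sets; different indices denote different indeterminates. Then the polynomials 1. $x_1x_2x_3-x_3x_2x_1$, with $x_1,x_3$ both in $Y^-$, both in $Z^+$, or both in $Z^-$; 2. $z_1z_2z_3$; 3. $[x_1,x_2]$, with $x_1,x_2$ both in the same one of the sets $Y^+,Y^-,Z^+,Z^-$; 4. $[y_1^+,y_2^-][x_3,x_4]$; 5. $[y_1^+,z_1z_2]$; 6. $[y_1^+,y_2^-]z_3$ and $z_3[y_1^+,y_2^-]$; 7. $[y_1^+,y_2^-]y_3^-+y_3^-[y_1^+,y_2^-]$; 8. $y_1^-z_1y_2^-$; 9. $z_1y_1^-z_2$; 10. $z_1^+z_2^-+z_2^-z_1^+$; 11. $z_1z_2y_1^-+y_1^-z_1z_2$;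 12. $[z_1,y_1^+]z_2+z_1[z_2,y_1^+]$ form a basis for the $(\mathbb Z_2,\ast)$-identities of $\mathcal U$: the intersection of all the $T_{\mathbb Z_2,\ast}$-ideals that contain them is exactly the set of $(\mathbb Z_2,\ast)$-identities of $\mathcal U$. -/

import Mathlib

/-! ### Graded algebras with graded involution -/

/-- An involution `a ↦ a⋆` of the `G`-graded algebra `A = ⊕ 𝒜 g`: an `F`-linear map with
`(a⋆)⋆ = a` and `(ab)⋆ = b⋆ a⋆` that maps every homogeneous component into itself. -/
structure GradedInvolution {F A G : Type*} [Field F] [Ring A] [Algebra F A]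
    (𝒜 : G → Submodule F A) where
  toFun : A →ₗ[F] A
  involutive : ∀ a, toFun (toFun a) = a
  anti_mul : ∀ a b, toFun (a * b) = toFun b * toFun a
  graded : ∀ g, ∀ a ∈ 𝒜 g, toFun a ∈ 𝒜 g

/-- `φ` is a homomorphism of `(G,⋆)`-algebras. -/
structure IsGradedInvHom {F A B G : Type*} [Field F] [Ring A] [Algebra F A] [Ring B] [Algebra F B]
    {𝒜 : G → Submodule F A} {ℬ : G → Submodule F B}
    (τ : GradedInvolution 𝒜) (σ : GradedInvolution ℬ) (φ : A →ₐ[F] B) : Prop where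
  map_mem : ∀ g, ∀ a ∈ 𝒜 g, φ a ∈ ℬ g
  map_inv : ∀ a, φ (τ.toFun a) = σ.toFun (φ a)

/-! ### The free `ℤ/2`-graded algebra with graded involution -/

/-- The four classes of indeterminates. -/
inductive IndetClass
  | Ypos | Yneg | Zpos | Zneg

namespace IndetClass

/-- Indeterminates in `Y` have degree `0`, those in `Z` have degree `1`. -/
def deg : IndetClass → ZMod 2
  | Ypos => 0
  | Yneg => 0
  | Zpos => 1
  | Zneg => 1

/-- `1` for the symmetric classes, `-1` for the skew-symmetric ones. -/
def sgn : IndetClass → ℤ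
  | Ypos => 1
  | Yneg => -1
  | Zpos => 1
  | Zneg => -1

theorem sgn_mul_sgn (c : IndetClass) : c.sgn * c.sgn = 1 := by cases c <;> rfl

end IndetClass

/-- An indeterminate: its class and its index. -/
structure Indet where
  cls : IndetClass
  idx : ℕ

/-- The free unital associative algebra `F⟨Y ∪ Z⟩`. -/
abbrev FreeYZ (F : Type*) [Field F] : Type _ := FreeAlgebra F Indet

/-- The indeterminate of class `c` with index `i`, as an element of the free algebra. -/
def indet (F : Type*) [Field F] (c : IndetClass) (i : ℕ) : FreeYZ F :=
  FreeAlgebra.ι F ⟨c, i⟩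

/-- The monomial given by a word in the indeterminates. -/
def word (F : Type*) [Field F] (l : List Indet) : FreeYZ F :=
  (l.map (FreeAlgebra.ι F)).prod

/-- The degree of a word: the sum of the degrees of its letters. -/
def wordDeg (l : List Indet) : ZMod 2 := (l.map fun v => v.cls.deg).sum

/-- The component of degree `d`: the span of the words of degree `d`. -/
def freeGrading (F : Type*) [Field F] (d : ZMod 2) : Submodule F (FreeYZ F) :=
  Submodule.span F {f | ∃ l : List Indet, wordDeg l = d ∧ word F l = f}

theorem word_mem_freeGrading (F : Type*) [Field F] (l : List Indet) :
    word F l ∈ freeGrading F (wordDeg l) :=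
  Submodule.subset_span ⟨l, rfl, rfl⟩

theorem ι_mem_freeGrading (F : Type*) [Field F] (v : Indet) :
    FreeAlgebra.ι F v ∈ freeGrading F v.cls.deg :=
  Submodule.subset_span ⟨[v], by simp [wordDeg], by simp [word]⟩

instance freeGrading.gradedMonoid (F : Type*) [Field F] :
    SetLike.GradedMonoid (freeGrading F) where
  one_mem := Submodule.subset_span ⟨[], by simp [wordDeg], by simp [word]⟩
  mul_mem := by
    intro i j a b ha hb
    have h := Submodule.mul_mem_mul ha hb
    rw [freeGrading, freeGrading, Submodule.span_mul_span] at h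
    refine Submodule.span_mono ?_ h
    rintro _ ⟨_, ⟨l, rfl, rfl⟩, _, ⟨l', rfl, rfl⟩, rfl⟩
    exact ⟨l ++ l', by simp [wordDeg], by simp [word]⟩

/-- The map that splits a polynomial into its homogeneous components. -/
noncomputable def freeDecompose (F : Type*) [Field F] :
    FreeYZ F →ₐ[F] DirectSum (ZMod 2) fun d => freeGrading F d :=
  FreeAlgebra.lift F fun v =>
    DirectSum.of (fun d => freeGrading F d) v.cls.deg ⟨FreeAlgebra.ι F v, ι_mem_freeGrading F v⟩

theorem freeDecompose_word (F : Type*) [Field F] (l : List Indet) :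
    freeDecompose F (word F l) =
      DirectSum.of (fun d => freeGrading F d) (wordDeg l)
        ⟨word F l, word_mem_freeGrading F l⟩ := by
  induction l with
  | nil =>
    have h : word F [] = 1 := by simp [word]
    refine (congrArg (freeDecompose F) h).trans ?_
    rw [map_one, DirectSum.one_def]
    exact DirectSum.of_eq_of_gradedMonoid_eq (Sigma.subtype_ext rfl h.symm)
  | cons v l ih =>
    have h : word F (v :: l) = FreeAlgebra.ι F v * word F l := by simp [word]
    refine (congrArg (freeDecompose F) h).trans ?_
    rw [map_mul, ih, freeDecompose, FreeAlgebra.lift_ι_apply, DirectSum.of_mul_of]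
    exact DirectSum.of_eq_of_gradedMonoid_eq
      (Sigma.subtype_ext (by simp [wordDeg, GradedMonoid.mk]) h.symm)

noncomputable instance freeGrading.gradedAlgebra (F : Type*) [Field F] :
    GradedAlgebra (freeGrading F) :=
  GradedAlgebra.ofAlgHom (freeGrading F) (freeDecompose F)
    (by
      ext v
      simp [freeDecompose])
    (by
      rintro d ⟨x, hx⟩
      change freeDecompose F x = _
      induction hx using Submodule.span_induction with
      | mem x hx =>
        obtain ⟨l, rfl, rfl⟩ := hx
        exact freeDecompose_word F l
      | zero => exact (map_zero _).trans (map_zero _).symm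
      | add x y hx hy ihx ihy =>
        rw [map_add, ihx, ihy, ← map_add]
        rfl
      | smul c x hx ih =>
        rw [map_smul, ih, ← DirectSum.lof_eq_of F, ← DirectSum.lof_eq_of F, ← map_smul]
        rfl)

/-- The anti-endomorphism of `F⟨Y ∪ Z⟩` that fixes the indeterminates in `Y⁺ ∪ Z⁺` and changes the
sign of those in `Y⁻ ∪ Z⁻`, as an algebra homomorphism to the opposite algebra. -/
def freeInvOp (F : Type*) [Field F] : FreeYZ F →ₐ[F] (FreeYZ F)ᵐᵒᵖ :=
  FreeAlgebra.lift F fun v => MulOpposite.op (v.cls.sgn • FreeAlgebra.ι F v)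

/-- The same map as an `F`-linear map from the free algebra to itself. -/
def freeInv (F : Type*) [Field F] : FreeYZ F →ₗ[F] FreeYZ F :=
  (MulOpposite.opLinearEquiv F).symm.toLinearMap ∘ₗ (freeInvOp F).toLinearMap

theorem freeInv_ι (F : Type*) [Field F] (v : Indet) :
    freeInv F (FreeAlgebra.ι F v) = v.cls.sgn • FreeAlgebra.ι F v := by
  simp [freeInv, freeInvOp]

theorem freeInv_mul (F : Type*) [Field F] (a b : FreeYZ F) :
    freeInv F (a * b) = freeInv F b * freeInv F a := by
  simp [freeInv]

theorem freeInv_algebraMap (F : Type*) [Field F] (r : F) :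
    freeInv F (algebraMap F (FreeYZ F) r) = algebraMap F (FreeYZ F) r := by
  simp [freeInv]

theorem freeInv_freeInv (F : Type*) [Field F] (a : FreeYZ F) : freeInv F (freeInv F a) = a := by
  induction a using FreeAlgebra.induction with
  | grade0 r => rw [freeInv_algebraMap, freeInv_algebraMap]
  | grade1 v => rw [freeInv_ι, map_zsmul, freeInv_ι, smul_smul, v.cls.sgn_mul_sgn, one_smul]
  | mul a b ha hb => rw [freeInv_mul, freeInv_mul, ha, hb]
  | add a b ha hb => rw [map_add, map_add, ha, hb]

theorem freeInv_word_mem (F : Type*) [Field F] (l : List Indet) :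
    freeInv F (word F l) ∈ freeGrading F (wordDeg l) := by
  induction l with
  | nil =>
    have h : word F [] = algebraMap F (FreeYZ F) 1 := by simp [word]
    rw [h, freeInv_algebraMap, ← h]
    exact word_mem_freeGrading F []
  | cons v l ih =>
    have h : word F (v :: l) = FreeAlgebra.ι F v * word F l := by simp [word]
    have hd : wordDeg (v :: l) = wordDeg l + v.cls.deg := by simp [wordDeg, add_comm]
    rw [h, hd, freeInv_mul, freeInv_ι]
    exact SetLike.mul_mem_graded ih (zsmul_mem (ι_mem_freeGrading F v) _)

/-- The graded involution of the free algebra `F⟨Y ∪ Z, ⋆⟩`. -/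
def freeInvolution (F : Type*) [Field F] : GradedInvolution (freeGrading F) where
  toFun := freeInv F
  involutive := freeInv_freeInv F
  anti_mul := freeInv_mul F
  graded := by
    intro g a ha
    induction ha using Submodule.span_induction with
    | mem x hx =>
      obtain ⟨l, rfl, rfl⟩ := hx
      exact freeInv_word_mem F l
    | zero => simp
    | add x y _ _ hx hy => rw [map_add]; exact add_mem hx hy
    | smul c x _ hx => rw [map_smul]; exact Submodule.smul_mem _ c hx

/-! ### Identities, `T`-ideals, bases -/

/-- The set of `(ℤ/2,⋆)`-identities of a `ℤ/2`-graded algebra with graded involution: the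
polynomials that vanish whenever each indeterminate is replaced by a homogeneous element of the
same degree which is symmetric or skew-symmetric as the indeterminate is. -/
def gradedStarIdentities {F A : Type*} [Field F] [Ring A] [Algebra F A]
    (𝒜 : ZMod 2 → Submodule F A) [GradedAlgebra 𝒜] (τ : GradedInvolution 𝒜) :
    Set (FreeYZ F) :=
  {f | ∀ a : Indet → A,
    (∀ v, a v ∈ 𝒜 v.cls.deg) → (∀ v, τ.toFun (a v) = v.cls.sgn • a v) →
      FreeAlgebra.lift F a f = 0}

/-- `T(ℤ/2,⋆)`-ideals: two-sided ideals of the free algebra that are invariant under its involution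
and under its endomorphisms as a `(ℤ/2,⋆)`-algebra. -/
structure IsTIdeal {F : Type*} [Field F] (I : Ideal (FreeYZ F)) : Prop where
  twoSided : I.IsTwoSided
  inv_mem : ∀ f ∈ I, (freeInvolution F).toFun f ∈ I
  map_mem : ∀ φ : FreeYZ F →ₐ[F] FreeYZ F,
    IsGradedInvHom (freeInvolution F) (freeInvolution F) φ → ∀ f ∈ I, φ f ∈ I

/-- `P` is a basis for `T`: the intersection of all the `T(ℤ/2,⋆)`-ideals that contain `P` is
`T`. -/
def IsIdentityBasis {F : Type*} [Field F] (P T : Set (FreeYZ F)) : Prop :=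
  ⋂₀ {J | ∃ I : Ideal (FreeYZ F), IsTIdeal I ∧ P ⊆ (I : Set (FreeYZ F)) ∧
    J = (I : Set (FreeYZ F))} = T

/-! ### Upper triangular matrices -/

/-- The algebra `UT_m(F)` of upper triangular matrices. -/
def UT (F : Type*) [Field F] (m : ℕ) : Subalgebra F (Matrix (Fin m) (Fin m) F) where
  carrier := {M | M.BlockTriangular id}
  mul_mem' := fun ha hb => ha.mul hb
  add_mem' := fun ha hb => ha.add hb
  algebraMap_mem' := fun r => by
    rw [Matrix.algebraMap_eq_diagonal]
    exact Matrix.blockTriangular_diagonal _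

/-- The elementary `G`-grading on `UT_m(F)` induced by the tuple `g`: the matrix unit `e_{ij}` has
degree `g i - g j` (the group is written additively), so that a matrix is homogeneous of degree `d`
when only its entries `(i,j)` with `g i - g j = d` can be nonzero. -/
def elementaryGrading (F : Type*) [Field F] {G : Type*} [AddCommGroup G] {m : ℕ} (g : Fin m → G)
    (d : G) : Submodule F (UT F m) where
  carrier := {M | ∀ i j, g i - g j ≠ d → M.1 i j = 0}
  add_mem' := fun ha hb i j h => by simp [ha i j h, hb i j h]
  zero_mem' := fun i j _ => by simp
  smul_mem' := fun c M hM i j h => by simp [hM i j h]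

/-- The part `M_{ij} e_{ij}` of the upper triangular matrix `M`. -/
def entryPart {F : Type*} [Field F] {m : ℕ} (i j : Fin m) : UT F m →+ UT F m where
  toFun M := ⟨Matrix.single i j (M.1 i j), by
    intro k l h
    by_cases hk : i = k ∧ j = l
    · obtain ⟨rfl, rfl⟩ := hk
      simpa using M.2 h
    · exact Matrix.single_apply_of_ne _ _ _ _ _ hk⟩
  map_zero' := Subtype.ext (by simp)
  map_add' M N := Subtype.ext (by simp [Matrix.single_add])

theorem entryPart_mem {F : Type*} [Field F] {G : Type*} [AddCommGroup G] {m : ℕ} (g : Fin m → G)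
    (i j : Fin m) (M : UT F m) : entryPart i j M ∈ elementaryGrading F g (g i - g j) := by
  intro k l h
  refine Matrix.single_apply_of_ne _ _ _ _ _ ?_
  rintro ⟨rfl, rfl⟩
  exact h rfl

theorem sum_entryPart {F : Type*} [Field F] {m : ℕ} (M : UT F m) :
    ∑ i, ∑ j, entryPart i j M = M := by
  refine Subtype.ext ?_
  push_cast
  exact (Matrix.matrix_eq_sum_single M.1).symm

instance elementaryGrading.gradedMonoid (F : Type*) [Field F] {G : Type*} [AddCommGroup G] {m : ℕ}
    (g : Fin m → G) : SetLike.GradedMonoid (elementaryGrading F g) where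
  one_mem := fun i j h => Matrix.one_apply_ne fun hij => h (by rw [hij, sub_self])
  mul_mem := by
    intro d e a b ha hb i j h
    change (a.1 * b.1) i j = 0
    rw [Matrix.mul_apply]
    refine Finset.sum_eq_zero fun k _ => ?_
    by_cases h1 : g i - g k = d
    · have h2 : g k - g j ≠ e := by
        rintro rfl
        exact h (by rw [← h1]; abel)
      simp [hb k j h2]
    · simp [ha i k h1]

noncomputable instance elementaryGrading.gradedAlgebra (F : Type*) [Field F] {G : Type*}
    [AddCommGroup G] [DecidableEq G] {m : ℕ} (g : Fin m → G) :
    GradedAlgebra (elementaryGrading F g) where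
  toGradedMonoid := elementaryGrading.gradedMonoid F g
  decompose' M := ∑ i, ∑ j, DirectSum.of (fun d => elementaryGrading F g d) (g i - g j)
    ⟨entryPart i j M, entryPart_mem g i j M⟩
  left_inv M := by
    simp only [map_sum, DirectSum.coeAddMonoidHom_of]
    exact sum_entryPart M
  right_inv x := by
    induction x using DirectSum.induction_on with
    | zero =>
      refine Finset.sum_eq_zero fun i _ => Finset.sum_eq_zero fun j _ => ?_
      have h : (⟨entryPart i j (DirectSum.coeAddMonoidHom (elementaryGrading F g) 0),
          entryPart_mem g i j _⟩ : elementaryGrading F g (g i - g j)) = 0 :=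
        Subtype.ext (by simp)
      rw [h, map_zero]
    | of d M =>
      have key : ∀ i j, DirectSum.of (fun d => elementaryGrading F g d) (g i - g j)
          ⟨entryPart i j M.1, entryPart_mem g i j M.1⟩ =
          DirectSum.of (fun d => elementaryGrading F g d) d
            (if h : g i - g j = d then ⟨entryPart i j M.1, h ▸ entryPart_mem g i j M.1⟩
              else 0) := by
        intro i j
        by_cases h : g i - g j = d
        · subst h
          simp
        · rw [dif_neg h, map_zero]
          have h0 : (⟨entryPart i j M.1, entryPart_mem g i j M.1⟩ :
              elementaryGrading F g (g i - g j)) = 0 := by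
            refine Subtype.ext (Subtype.ext ?_)
            simp [entryPart, M.2 i j h]
          rw [h0, map_zero]
      simp only [DirectSum.coeAddMonoidHom_of, key, ← map_sum]
      congr 1
      refine Subtype.ext ?_
      conv_rhs => rw [← sum_entryPart M.1]
      push_cast
      refine Finset.sum_congr rfl fun i _ => Finset.sum_congr rfl fun j _ => ?_
      by_cases h : g i - g j = d
      · simp [h]
      · rw [dif_neg h]
        refine Subtype.ext ?_
        simp [entryPart, M.2 i j h]
    | add x y hx hy =>
      conv_rhs => rw [← hx, ← hy]
      simp only [← Finset.sum_add_distrib, ← map_add]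
      refine Finset.sum_congr rfl fun i _ => Finset.sum_congr rfl fun j _ => ?_
      congr 1
      exact Subtype.ext (by simp)

/-- The reflection involution `e_{ij} ↦ e_{m+1-j,m+1-i}` of `UT_m(F)`, as a linear map. -/
def reflection (F : Type*) [Field F] (m : ℕ) : UT F m →ₗ[F] UT F m where
  toFun M := ⟨Matrix.of fun i j => M.1 j.rev i.rev, fun _ _ h => M.2 (Fin.rev_lt_rev.mpr h)⟩
  map_add' _ _ := rfl
  map_smul' _ _ := rfl

theorem reflection_apply {F : Type*} [Field F] {m : ℕ} (M : UT F m) (i j : Fin m) :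
    (reflection F m M).1 i j = M.1 j.rev i.rev := rfl

/-- The tuple `(0,1,0)` of elements of `ℤ/2`. -/
def tuple010 : Fin 3 → ZMod 2 := ![0, 1, 0]

theorem tuple010_rev : ∀ i j : Fin 3,
    tuple010 j.rev - tuple010 i.rev = tuple010 i - tuple010 j := by
  decide

/-- The reflection involution as a graded involution of `UT_3(F)` with the elementary grading
induced by `(0,1,0)`. -/
def reflectionInvolution (F : Type*) [Field F] :
    GradedInvolution (elementaryGrading F tuple010) where
  toFun := reflection F 3
  involutive M := Subtype.ext (by
    ext i j
    rw [reflection_apply, reflection_apply, Fin.rev_rev, Fin.rev_rev])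
  anti_mul M N := Subtype.ext (by
    ext i j
    simp only [reflection_apply, MulMemClass.coe_mul, Matrix.mul_apply]
    rw [← Equiv.sum_comp Fin.revPerm]
    simp [mul_comm])
  graded _ _ hM i j h := hM j.rev i.rev (by rwa [tuple010_rev])

/-! ### The polynomials -/

open IndetClass in
/-- The twelve families of polynomials. -/
inductive IsBasisPoly (F : Type*) [Field F] : FreeYZ F → Prop
  -- `x₁x₂x₃ - x₃x₂x₁`, with `x₁`, `x₃` both in `Y⁻`, both in `Z⁺` or both in `Z⁻`
  | id1 (c d : IndetClass) (hc : c = Yneg ∨ c = Zpos ∨ c = Zneg) :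
      IsBasisPoly F (indet F c 1 * indet F d 2 * indet F c 3
        - indet F c 3 * indet F d 2 * indet F c 1)
  -- `z₁z₂z₃`
  | id2 (c₁ c₂ c₃ : IndetClass) (h₁ : c₁.deg = 1) (h₂ : c₂.deg = 1) (h₃ : c₃.deg = 1) :
      IsBasisPoly F (indet F c₁ 1 * indet F c₂ 2 * indet F c₃ 3)
  -- `[x₁,x₂]`, with `x₁`, `x₂` in the same one of the four classes
  | id3 (c : IndetClass) :
      IsBasisPoly F ⁅indet F c 1, indet F c 2⁆
  -- `[y₁⁺,y₂⁻][x₃,x₄]`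
  | id4 (c d : IndetClass) :
      IsBasisPoly F (⁅indet F Ypos 1, indet F Yneg 2⁆ * ⁅indet F c 3, indet F d 4⁆)
  -- `[y₁⁺,z₁z₂]`
  | id5 (c₁ c₂ : IndetClass) (h₁ : c₁.deg = 1) (h₂ : c₂.deg = 1) :
      IsBasisPoly F ⁅indet F Ypos 1, indet F c₁ 1 * indet F c₂ 2⁆
  -- `[y₁⁺,y₂⁻]z₃` and `z₃[y₁⁺,y₂⁻]`
  | id6_left (c : IndetClass) (h : c.deg = 1) :
      IsBasisPoly F (⁅indet F Ypos 1, indet F Yneg 2⁆ * indet F c 3)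
  | id6_right (c : IndetClass) (h : c.deg = 1) :
      IsBasisPoly F (indet F c 3 * ⁅indet F Ypos 1, indet F Yneg 2⁆)
  -- `[y₁⁺,y₂⁻]y₃⁻ + y₃⁻[y₁⁺,y₂⁻]`
  | id7 :
      IsBasisPoly F (⁅indet F Ypos 1, indet F Yneg 2⁆ * indet F Yneg 3
        + indet F Yneg 3 * ⁅indet F Ypos 1, indet F Yneg 2⁆)
  -- `y₁⁻z₁y₂⁻`
  | id8 (c : IndetClass) (h : c.deg = 1) :
      IsBasisPoly F (indet F Yneg 1 * indet F c 1 * indet F Yneg 2)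
  -- `z₁y₁⁻z₂`
  | id9 (c₁ c₂ : IndetClass) (h₁ : c₁.deg = 1) (h₂ : c₂.deg = 1) :
      IsBasisPoly F (indet F c₁ 1 * indet F Yneg 1 * indet F c₂ 2)
  -- `z₁⁺z₂⁻ + z₂⁻z₁⁺`
  | id10 :
      IsBasisPoly F (indet F Zpos 1 * indet F Zneg 2 + indet F Zneg 2 * indet F Zpos 1)
  -- `z₁z₂y₁⁻ + y₁⁻z₁z₂`
  | id11 (c₁ c₂ : IndetClass) (h₁ : c₁.deg = 1) (h₂ : c₂.deg = 1) :
      IsBasisPoly F (indet F c₁ 1 * indet F c₂ 2 * indet F Yneg 1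
        + indet F Yneg 1 * indet F c₁ 1 * indet F c₂ 2)
  -- `[z₁,y₁⁺]z₂ + z₁[z₂,y₁⁺]`
  | id12 (c₁ c₂ : IndetClass) (h₁ : c₁.deg = 1) (h₂ : c₂.deg = 1) :
      IsBasisPoly F (⁅indet F c₁ 1, indet F Ypos 1⁆ * indet F c₂ 2
        + indet F c₁ 1 * ⁅indet F c₂ 2, indet F Ypos 1⁆)

/-! ### Elements of a given class in a graded algebra with graded involution -/

/-! `UT_3` satisfies the twelve families by computation (`satisfiesBasis_reflectionInvolution`), and
its identities form a T-ideal, so they contain the intersection. For the reverse inclusion, let `I`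
be a T-ideal containing the families. The quotient `A` of the free algebra by `I` inherits
components and an involution, and the families vanish at all admissible substitutions in `A`. Since
`F` is infinite, an identity of `UT_3` vanishes at generic matrices with independent polynomial
entries (`lift_genericMatrix_eq_zero`). It therefore suffices that the value of a polynomial in `A`
is a linear function of its value at the generic matrices. By linearity this is a statement about
words (`recover_genericWord`); no basis of the relatively free algebra has to be exhibited.

The linear map `recover` reads off monomials of the entries, and the cases are sorted by the number
of odd letters. With three or more, both values vanish. With two, the generic value is a multiple of
`e₁₃`; the block from the first odd letter to the second commutes with `y⁺` and anticommutes with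
`y⁻`, so all outer letters gather on its left, and the two odd letters may be exchanged up to sign.
With one, the letters on each side of `z` commute next to it; the `(1,2)` entry determines the word
if no `y⁻` follows `z`, the `(2,3)` entry if none precedes it, and otherwise the word is zero.

Even words are the delicate case: their `(1,1)` entry only records the multiset of letters.
Exchanging adjacent `y⁺`, `y⁻` changes the value by `u[y⁺,y⁻]v` and the `(1,3)` entry by a single
monomial with coefficient `±2`, and the relations make `u[y⁺,y⁻]v` a function of that monomial.
Hence the value minus the part recovered from the `(1,3)` entry, the `residue`, depends only on the
multiset (`residue_swap`) and can be assigned to the `(1,1)` monomial. -/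

noncomputable instance : DecidableEq Indet := Classical.decEq _

section Classes

variable {F A : Type*} [Field F] [Ring A] [Algebra F A] {D : ZMod 2 → Submodule F A}

/-- `x` is homogeneous of the degree of the class `c`, and symmetric or skew as `c` is. -/
def HasClass (τ : GradedInvolution D) (c : IndetClass) (x : A) : Prop :=
  x ∈ D c.deg ∧ τ.toFun x = c.sgn • x

/-- The polynomials of the basis vanish at all admissible substitutions in `A`. -/
def SatisfiesBasis (τ : GradedInvolution D) : Prop :=
  ∀ f : FreeYZ F, IsBasisPoly F f → ∀ a : Indet → A, (∀ v, HasClass τ v.cls (a v)) →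
    FreeAlgebra.lift F a f = 0

theorem HasClass.zero (τ : GradedInvolution D) (c : IndetClass) : HasClass τ c 0 :=
  ⟨zero_mem _, by simp⟩

theorem HasClass.update {τ : GradedInvolution D} {a : Indet → A}
    (ha : ∀ v, HasClass τ v.cls (a v)) {w : Indet} {x : A} (hx : HasClass τ w.cls x) (v : Indet) :
    HasClass τ v.cls (Function.update a w x v) := by
  by_cases h : v = w
  · subst h; simpa using hx
  · simpa [h] using ha v

variable [CharZero F]

theorem exists_classes (τ : GradedInvolution D) {d : ZMod 2} {x : A} (hx : x ∈ D d) :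
    ∃ p q, (p ∈ D d ∧ τ.toFun p = p) ∧ (q ∈ D d ∧ τ.toFun q = -q) ∧ x = p + q := by
  refine ⟨(2⁻¹ : F) • (x + τ.toFun x), (2⁻¹ : F) • (x - τ.toFun x), ⟨?_, ?_⟩, ⟨?_, ?_⟩, ?_⟩
  · exact Submodule.smul_mem _ _ (add_mem hx (τ.graded _ _ hx))
  · rw [map_smul, map_add, τ.involutive, add_comm]
  · exact Submodule.smul_mem _ _ (sub_mem hx (τ.graded _ _ hx))
  · rw [map_smul, map_sub, τ.involutive, ← smul_neg, neg_sub]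
  · rw [← smul_add, add_add_sub_cancel, ← two_smul F x, smul_smul, inv_mul_cancel₀ two_ne_zero,
      one_smul]

theorem exists_classes_odd (τ : GradedInvolution D) {x : A} (hx : x ∈ D 1) :
    ∃ p q, HasClass τ .Zpos p ∧ HasClass τ .Zneg q ∧ x = p + q := by
  obtain ⟨p, q, ⟨hp, hp'⟩, ⟨hq, hq'⟩, h⟩ := exists_classes τ hx
  exact ⟨p, q, ⟨hp, by simpa [IndetClass.sgn] using hp'⟩,
    ⟨hq, by simpa [IndetClass.sgn] using hq'⟩, h⟩

theorem exists_classes_even (τ : GradedInvolution D) {x : A} (hx : x ∈ D 0) :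
    ∃ p q, HasClass τ .Ypos p ∧ HasClass τ .Yneg q ∧ x = p + q := by
  obtain ⟨p, q, ⟨hp, hp'⟩, ⟨hq, hq'⟩, h⟩ := exists_classes τ hx
  exact ⟨p, q, ⟨hp, by simpa [IndetClass.sgn] using hp'⟩,
    ⟨hq, by simpa [IndetClass.sgn] using hq'⟩, h⟩

/-- A predicate on odd elements that is additive holds if it holds on both odd classes. -/
theorem odd_induction (τ : GradedInvolution D) {P : A → Prop}
    (hadd : ∀ x y, P x → P y → P (x + y))
    (h : ∀ c x, c.deg = 1 → HasClass τ c x → P x) {x : A} (hx : x ∈ D 1) : P x := by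
  obtain ⟨p, q, hp, hq, rfl⟩ := exists_classes_odd τ hx
  exact hadd _ _ (h _ _ rfl hp) (h _ _ rfl hq)

/-- A predicate on even elements that is additive holds if it holds on both even classes. -/
theorem even_induction (τ : GradedInvolution D) {P : A → Prop}
    (hadd : ∀ x y, P x → P y → P (x + y))
    (h : ∀ c x, HasClass τ c x → P x) {x : A} (hx : x ∈ D 0) : P x := by
  obtain ⟨p, q, hp, hq, rfl⟩ := exists_classes_even τ hx
  exact hadd _ _ (h _ _ hp) (h _ _ hq)

omit [CharZero F] in
theorem HasClass.commutator_even {τ : GradedInvolution D} [SetLike.GradedMonoid D] {x y : A}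
    (hx : HasClass τ .Ypos x) (hy : HasClass τ .Yneg y) : HasClass τ .Ypos (x * y - y * x) := by
  have h1 := SetLike.mul_mem_graded hx.1 hy.1
  have h2 := SetLike.mul_mem_graded hy.1 hx.1
  refine ⟨sub_mem (by simpa [IndetClass.deg] using h1) (by simpa [IndetClass.deg] using h2), ?_⟩
  have e1 := hx.2
  have e2 := hy.2
  simp only [IndetClass.sgn] at e1 e2 ⊢
  rw [map_sub, τ.anti_mul, τ.anti_mul, e1, e2]
  simp only [one_smul, neg_smul, neg_mul, mul_neg]
  abel

/-! ### The identities as relations between elements of an algebra -/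

namespace SatisfiesBasis

variable {τ : GradedInvolution D} (h : SatisfiesBasis τ)

include h

omit [CharZero F] in
theorem swap_outer {c d : IndetClass} (hc : c ≠ .Ypos) {x₁ x₂ x₃ : A} (h₁ : HasClass τ c x₁)
    (h₂ : HasClass τ d x₂) (h₃ : HasClass τ c x₃) : x₁ * x₂ * x₃ = x₃ * x₂ * x₁ := by
  have := h _ (.id1 c d (by cases c <;> simp at hc ⊢))
    (Function.update (Function.update (Function.update 0 ⟨c, 1⟩ x₁) ⟨d, 2⟩ x₂) ⟨c, 3⟩ x₃)
    (HasClass.update (HasClass.update (HasClass.update (fun v => HasClass.zero _ _) h₁) h₂) h₃)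
  simpa [indet, Function.update_apply, sub_eq_zero] using this

omit [CharZero F] in
theorem comm {c : IndetClass} {x₁ x₂ : A} (h₁ : HasClass τ c x₁)
    (h₂ : HasClass τ c x₂) : x₁ * x₂ = x₂ * x₁ := by
  have := h _ (.id3 c)
    (Function.update (Function.update 0 ⟨c, 1⟩ x₁) ⟨c, 2⟩ x₂)
    (HasClass.update (HasClass.update (fun v => HasClass.zero _ _) h₁) h₂)
  simpa [indet, Function.update_apply, sub_eq_zero, Ring.lie_def] using this

/-- Multilinearity frees the odd arguments from being symmetric or skew. This generality is needed
because the product of an odd letter with an even word has no definite symmetry; the same applies to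
the lemmas below with odd arguments. -/
theorem odd_mul_odd_mul_odd {x₁ x₂ x₃ : A} (h₁ : x₁ ∈ D 1) (h₂ : x₂ ∈ D 1) (h₃ : x₃ ∈ D 1) :
    x₁ * x₂ * x₃ = 0 := by
  refine odd_induction τ (P := fun x => x * x₂ * x₃ = 0)
    (fun x y hx hy => by simp [add_mul, hx, hy]) (fun c₁ x₁ hc₁ h₁ => ?_) h₁
  refine odd_induction τ (P := fun x => x₁ * x * x₃ = 0)
    (fun x y hx hy => by simp [add_mul, mul_add, hx, hy]) (fun c₂ x₂ hc₂ h₂ => ?_) h₂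
  refine odd_induction τ (P := fun x => x₁ * x₂ * x = 0)
    (fun x y hx hy => by simp [mul_add, hx, hy]) (fun c₃ x₃ hc₃ h₃ => ?_) h₃
  have := h _ (.id2 c₁ c₂ c₃ hc₁ hc₂ hc₃)
    (Function.update (Function.update (Function.update 0 ⟨c₁, 1⟩ x₁) ⟨c₂, 2⟩ x₂) ⟨c₃, 3⟩ x₃)
    (HasClass.update (HasClass.update (HasClass.update (fun v => HasClass.zero _ _) h₁) h₂) h₃)
  simpa [indet, Function.update_apply] using this

theorem commutator_mul_commutator {y₁ y₂ x₃ x₄ : A} (h₁ : HasClass τ .Ypos y₁)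
    (h₂ : HasClass τ .Yneg y₂) (h₃ : x₃ ∈ D 0) (h₄ : x₄ ∈ D 0) :
    (y₁ * y₂ - y₂ * y₁) * (x₃ * x₄ - x₄ * x₃) = 0 := by
  refine even_induction τ (P := fun x => (y₁ * y₂ - y₂ * y₁) * (x * x₄ - x₄ * x) = 0)
    (fun x y hx hy => by
      rw [add_mul, mul_add, add_sub_add_comm, mul_add, hx, hy, add_zero])
    (fun c x₃ h₃ => ?_) h₃
  refine even_induction τ (P := fun x => (y₁ * y₂ - y₂ * y₁) * (x₃ * x - x * x₃) = 0)
    (fun x y hx hy => by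
      rw [add_mul, mul_add, add_sub_add_comm, mul_add, hx, hy, add_zero])
    (fun d x₄ h₄ => ?_) h₄
  have := h _ (.id4 c d)
    (Function.update (Function.update (Function.update (Function.update 0
      ⟨.Ypos, 1⟩ y₁) ⟨.Yneg, 2⟩ y₂) ⟨c, 3⟩ x₃) ⟨d, 4⟩ x₄)
    (HasClass.update (HasClass.update (HasClass.update
      (HasClass.update (fun v => HasClass.zero _ _) h₁) h₂) h₃) h₄)
  simpa [indet, Function.update_apply, Ring.lie_def] using this

theorem pos_comm_odd_mul_odd {y z₁ z₂ : A} (hy : HasClass τ .Ypos y) (h₁ : z₁ ∈ D 1)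
    (h₂ : z₂ ∈ D 1) : y * (z₁ * z₂) = z₁ * z₂ * y := by
  refine odd_induction τ (P := fun x => y * (x * z₂) = x * z₂ * y)
    (fun x y hx hy => by rw [add_mul, mul_add, hx, hy, add_mul]) (fun c₁ z₁ hc₁ h₁ => ?_) h₁
  refine odd_induction τ (P := fun x => y * (z₁ * x) = z₁ * x * y)
    (fun x y hx hy => by rw [mul_add, mul_add, hx, hy, add_mul]) (fun c₂ z₂ hc₂ h₂ => ?_) h₂
  have := h _ (.id5 c₁ c₂ hc₁ hc₂)
    (Function.update (Function.update (Function.update 0 ⟨.Ypos, 1⟩ y) ⟨c₁, 1⟩ z₁) ⟨c₂, 2⟩ z₂)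
    (HasClass.update (HasClass.update (HasClass.update (fun v => HasClass.zero _ _) hy) h₁) h₂)
  have hne : IndetClass.Ypos ≠ c₁ := by rintro rfl; simp [IndetClass.deg] at hc₁
  simpa [indet, Function.update_apply, Ring.lie_def, sub_eq_zero, hne] using this

theorem commutator_mul_odd {y₁ y₂ z : A} (h₁ : HasClass τ .Ypos y₁) (h₂ : HasClass τ .Yneg y₂)
    (hz : z ∈ D 1) : (y₁ * y₂ - y₂ * y₁) * z = 0 := by
  refine odd_induction τ (P := fun x => (y₁ * y₂ - y₂ * y₁) * x = 0)
    (fun x y hx hy => by rw [mul_add, hx, hy, add_zero]) (fun c z hc hz => ?_) hz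
  have := h _ (.id6_left c hc)
    (Function.update (Function.update (Function.update 0 ⟨.Ypos, 1⟩ y₁) ⟨.Yneg, 2⟩ y₂) ⟨c, 3⟩ z)
    (HasClass.update (HasClass.update (HasClass.update (fun v => HasClass.zero _ _) h₁) h₂) hz)
  simpa [indet, Function.update_apply, Ring.lie_def] using this

theorem odd_mul_commutator {y₁ y₂ z : A} (h₁ : HasClass τ .Ypos y₁) (h₂ : HasClass τ .Yneg y₂)
    (hz : z ∈ D 1) : z * (y₁ * y₂ - y₂ * y₁) = 0 := by
  refine odd_induction τ (P := fun x => x * (y₁ * y₂ - y₂ * y₁) = 0)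
    (fun x y hx hy => by rw [add_mul, hx, hy, add_zero]) (fun c z hc hz => ?_) hz
  have := h _ (.id6_right c hc)
    (Function.update (Function.update (Function.update 0 ⟨.Ypos, 1⟩ y₁) ⟨.Yneg, 2⟩ y₂) ⟨c, 3⟩ z)
    (HasClass.update (HasClass.update (HasClass.update (fun v => HasClass.zero _ _) h₁) h₂) hz)
  simpa [indet, Function.update_apply, Ring.lie_def] using this

omit [CharZero F] in
theorem commutator_mul_neg {y₁ y₂ y₃ : A} (h₁ : HasClass τ .Ypos y₁) (h₂ : HasClass τ .Yneg y₂)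
    (h₃ : HasClass τ .Yneg y₃) :
    (y₁ * y₂ - y₂ * y₁) * y₃ = -(y₃ * (y₁ * y₂ - y₂ * y₁)) := by
  have := h _ .id7
    (Function.update (Function.update (Function.update 0 ⟨.Ypos, 1⟩ y₁) ⟨.Yneg, 2⟩ y₂)
      ⟨.Yneg, 3⟩ y₃)
    (HasClass.update (HasClass.update (HasClass.update (fun v => HasClass.zero _ _) h₁) h₂) h₃)
  simpa [indet, Function.update_apply, Ring.lie_def, add_eq_zero_iff_eq_neg] using this

theorem neg_mul_odd_mul_neg {y₁ y₂ z : A} (h₁ : HasClass τ .Yneg y₁) (h₂ : HasClass τ .Yneg y₂)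
    (hz : z ∈ D 1) : y₁ * z * y₂ = 0 := by
  refine odd_induction τ (P := fun x => y₁ * x * y₂ = 0)
    (fun x y hx hy => by rw [mul_add, add_mul, hx, hy, add_zero]) (fun c z hc hz => ?_) hz
  have := h _ (.id8 c hc)
    (Function.update (Function.update (Function.update 0 ⟨.Yneg, 1⟩ y₁) ⟨c, 1⟩ z) ⟨.Yneg, 2⟩ y₂)
    (HasClass.update (HasClass.update (HasClass.update (fun v => HasClass.zero _ _) h₁) hz) h₂)
  have hne : IndetClass.Yneg ≠ c := by rintro rfl; simp [IndetClass.deg] at hc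
  simpa [indet, Function.update_apply, hne] using this

theorem odd_mul_neg_mul_odd {z₁ y z₂ : A} (h₁ : z₁ ∈ D 1) (hy : HasClass τ .Yneg y)
    (h₂ : z₂ ∈ D 1) : z₁ * y * z₂ = 0 := by
  refine odd_induction τ (P := fun x => x * y * z₂ = 0)
    (fun x y hx hy => by simp [add_mul, hx, hy]) (fun c₁ z₁ hc₁ h₁ => ?_) h₁
  refine odd_induction τ (P := fun x => z₁ * y * x = 0)
    (fun x y hx hy => by simp [mul_add, hx, hy]) (fun c₂ z₂ hc₂ h₂ => ?_) h₂
  have := h _ (.id9 c₁ c₂ hc₁ hc₂)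
    (Function.update (Function.update (Function.update 0 ⟨c₁, 1⟩ z₁) ⟨.Yneg, 1⟩ y) ⟨c₂, 2⟩ z₂)
    (HasClass.update (HasClass.update (HasClass.update (fun v => HasClass.zero _ _) h₁) hy) h₂)
  have hne : c₁ ≠ IndetClass.Yneg := by rintro rfl; simp [IndetClass.deg] at hc₁
  simpa [indet, Function.update_apply, hne] using this

omit [CharZero F] in
theorem zpos_mul_zneg {z₁ z₂ : A} (h₁ : HasClass τ .Zpos z₁) (h₂ : HasClass τ .Zneg z₂) :
    z₁ * z₂ = -(z₂ * z₁) := by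
  have := h _ .id10
    (Function.update (Function.update 0 ⟨.Zpos, 1⟩ z₁) ⟨.Zneg, 2⟩ z₂)
    (HasClass.update (HasClass.update (fun v => HasClass.zero _ _) h₁) h₂)
  simpa [indet, Function.update_apply, add_eq_zero_iff_eq_neg] using this

theorem odd_mul_odd_mul_neg {z₁ z₂ y : A} (h₁ : z₁ ∈ D 1) (h₂ : z₂ ∈ D 1)
    (hy : HasClass τ .Yneg y) : z₁ * z₂ * y = -(y * (z₁ * z₂)) := by
  refine odd_induction τ (P := fun x => x * z₂ * y = -(y * (x * z₂)))
    (fun x y hx hy => by simp only [add_mul, mul_add, hx, hy, neg_add])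
    (fun c₁ z₁ hc₁ h₁ => ?_) h₁
  refine odd_induction τ (P := fun x => z₁ * x * y = -(y * (z₁ * x)))
    (fun x y hx hy => by simp only [mul_add, add_mul, hx, hy, neg_add])
    (fun c₂ z₂ hc₂ h₂ => ?_) h₂
  have := h _ (.id11 c₁ c₂ hc₁ hc₂)
    (Function.update (Function.update (Function.update 0 ⟨c₁, 1⟩ z₁) ⟨c₂, 2⟩ z₂) ⟨.Yneg, 1⟩ y)
    (HasClass.update (HasClass.update (HasClass.update (fun v => HasClass.zero _ _) h₁) h₂) hy)
  have hne : c₁ ≠ IndetClass.Yneg := by rintro rfl; simp [IndetClass.deg] at hc₁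
  simpa [indet, Function.update_apply, hne, add_eq_zero_iff_eq_neg, mul_assoc] using this

omit [CharZero F] in
/-- Two skew even elements may be exchanged in `y₁ * [x, y₂]`. -/
theorem neg_mul_commutator_swap {x y₁ y₂ : A} (hx : HasClass τ .Ypos x)
    (h₁ : HasClass τ .Yneg y₁) (h₂ : HasClass τ .Yneg y₂) :
    y₁ * (x * y₂ - y₂ * x) = y₂ * (x * y₁ - y₁ * x) := by
  -- Moving the skew factor behind the commutator turns the sides, up to sign, into `x y₂ y₁ - y₂ x
  -- y₁` and `x y₁ y₂ - y₁ x y₂`. These agree because skew even elements commute and may be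
  -- exchanged around `x`.
  rw [← neg_inj, ← h.commutator_mul_neg hx h₂ h₁, ← h.commutator_mul_neg hx h₁ h₂, sub_mul, sub_mul,
    mul_assoc x, mul_assoc x, h.comm h₁ h₂, h.swap_outer (by simp) h₁ hx h₂]

variable [SetLike.GradedMonoid D]

/-- The product of two commutators, with an even element between them, vanishes. -/
theorem commutator_mul_mul_commutator {x x' y y' w : A} (hx : HasClass τ .Ypos x)
    (hy : HasClass τ .Yneg y) (hw : w ∈ D 0) (hx' : HasClass τ .Ypos x')
    (hy' : HasClass τ .Yneg y') :
    (x * y - y * x) * w * (x' * y' - y' * x') = 0 := by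
  -- The commutator `[x', y']` is itself even, so identity 4 applied to `w` and `[x', y']` lets `w`
  -- pass behind it; the two commutators then become adjacent.
  have h1 := h.commutator_mul_commutator hx hy hw (HasClass.commutator_even hx' hy').1
  have h2 := h.commutator_mul_commutator hx hy hx'.1 hy'.1
  rw [mul_sub, sub_eq_zero, ← mul_assoc] at h1
  rw [h1, ← mul_assoc, h2, zero_mul]

/-- Two classed odd elements with a symmetric even element between them may be exchanged. -/
theorem odd_mul_pos_mul_odd {c d : IndetClass} (hc : c.deg = 1) (hd : d.deg = 1) {z z' x : A}
    (hz : HasClass τ c z) (hz' : HasClass τ d z') (hx : HasClass τ .Ypos x) :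
    c.sgn • (z' * x * z) = d.sgn • (z * x * z') := by
  -- For symmetric `z` and skew `z'`, split `2xz'` into the skew part `xz' + z'x`, which
  -- anticommutes with `z`, and the symmetric part `xz' - z'x`, which commutes with it.
  have key : ∀ {z z' : A}, HasClass τ .Zpos z → HasClass τ .Zneg z' →
      z * x * z' = -(z' * x * z) := by
    intro z z' hz hz'
    have m1 : x * z' ∈ D 1 := by simpa [IndetClass.deg] using SetLike.mul_mem_graded hx.1 hz'.1
    have m2 : z' * x ∈ D 1 := by simpa [IndetClass.deg] using SetLike.mul_mem_graded hz'.1 hx.1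
    have e1 : τ.toFun x = x := by simpa [IndetClass.sgn] using hx.2
    have e2 : τ.toFun z' = -z' := by simpa [IndetClass.sgn] using hz'.2
    have k1 : HasClass τ .Zneg (x * z' + z' * x) := by
      refine ⟨add_mem m1 m2, ?_⟩
      rw [map_add, τ.anti_mul, τ.anti_mul, e1, e2]
      simp only [IndetClass.sgn, neg_smul, one_smul, neg_mul, mul_neg]
      abel
    have k2 : HasClass τ .Zpos (x * z' - z' * x) := by
      refine ⟨sub_mem m1 m2, ?_⟩
      rw [map_sub, τ.anti_mul, τ.anti_mul, e1, e2]
      simp only [IndetClass.sgn, one_smul, neg_mul, mul_neg]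
      abel
    have r1 := h.zpos_mul_zneg hz k1
    have r2 := h.comm hz k2
    have r : (2 : F) • (z * x * z') = (2 : F) • (-(z' * x * z)) := by
      rw [two_smul, two_smul]
      have := congrArg₂ (· + ·) r1 r2
      simp only [mul_add, add_mul, mul_sub, sub_mul, mul_assoc] at this ⊢
      calc _ = z * (x * z') + z * (z' * x) + (z * (x * z') - z * (z' * x)) := by abel
        _ = _ := by rw [this]; abel
    exact (smul_right_injective A (two_ne_zero (α := F))) r
  cases c <;> cases d <;> simp only [IndetClass.deg, zero_ne_one] at hc hd <;>
    simp only [IndetClass.sgn, one_smul, neg_smul]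
  · exact h.swap_outer (by simp) hz' hx hz
  · rw [key hz hz', neg_neg]
  · rw [key hz' hz, neg_neg]
  · rw [h.swap_outer (by simp) hz' hx hz]

end SatisfiesBasis

end Classes

/-! ### Products of commuting families indexed by exponents -/

section CommProd

variable {σ M : Type*} [Monoid M]

/-- The product of the elements `g s`, each taken `m s` times; meant for commuting families. -/
noncomputable def commProd (g : σ → M) (m : σ →₀ ℕ) : M :=
  ((Finsupp.toMultiset m).toList.map g).prod

@[simp]
theorem commProd_zero (g : σ → M) : commProd g 0 = 1 := by simp [commProd]

/-- The list underlying a multiset has an unspecified order, so the two lists agree only up to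
permutation; this is where commutativity of the family enters. -/
theorem commProd_add {g : σ → M} (hg : ∀ s t, Commute (g s) (g t)) (m n : σ →₀ ℕ) :
    commProd g (m + n) = commProd g m * commProd g n := by
  rw [commProd, commProd, commProd, ← List.prod_append, ← List.map_append]
  refine List.Perm.prod_eq' (List.Perm.map g ?_) ?_
  · rw [← Multiset.coe_eq_coe, ← Multiset.coe_add]
    simp
  · refine List.pairwise_map.mpr (List.Pairwise.imp (fun _ => hg _ _) (List.pairwise_of_forall
      (R := fun _ _ => True) fun _ _ => trivial))

@[simp]
theorem commProd_single (g : σ → M) (s : σ) : commProd g (Finsupp.single s 1) = g s := by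
  simp [commProd, Finsupp.toMultiset_single]

theorem commProd_sum {g : σ → M} (hg : ∀ s t, Commute (g s) (g t)) (l : List (σ →₀ ℕ)) :
    commProd g l.sum = (l.map (commProd g)).prod := by
  induction l with
  | nil => simp
  | cons m l ih => simp [commProd_add hg, ih]

theorem commProd_mem {g : σ → M} {P : M → Prop} (h1 : P 1) (hmul : ∀ x y, P x → P y → P (x * y))
    (hg : ∀ s, P (g s)) (m : σ →₀ ℕ) : P (commProd g m) := by
  rw [commProd]
  induction (Finsupp.toMultiset m).toList with
  | nil => simpa
  | cons s l ih => simpa using hmul _ _ (hg s) ih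

end CommProd

/-! ### Words and their exponents -/

/-- The variables of the generic matrices: `diag v` is the `(1,1)` entry of the generic matrix of an
even indeterminate `v` and the `(1,2)` entry of that of an odd one, `mid i` and `corner i` are the
`(2,2)` and the `(1,3)` entry of that of `yᵢ⁺`. -/
inductive GenVar
  | diag (v : Indet)
  | mid (i : ℕ)
  | corner (i : ℕ)

/-- All letters of the word have degree `0`. -/
def EvenWord (l : List Indet) : Prop := ∀ v ∈ l, v.cls.deg = 0

/-- The exponent of the product of the variables `diag v`, `v` running over the word. -/
noncomputable def wordExp (l : List Indet) : GenVar →₀ ℕ :=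
  (l.map fun v => Finsupp.single (.diag v) 1).sum

/-- The exponent of the product of the variables `mid v.idx`, `v` running over the word. -/
noncomputable def midExp (l : List Indet) : GenVar →₀ ℕ :=
  (l.map fun v => Finsupp.single (.mid v.idx) 1).sum

/-- The sign of a word: the product of the signs of its letters. -/
def wordSgn (l : List Indet) : ℤ := (l.map fun v => v.cls.sgn).prod

@[simp] theorem wordExp_nil : wordExp [] = 0 := rfl

@[simp] theorem wordExp_cons (v : Indet) (l : List Indet) :
    wordExp (v :: l) = Finsupp.single (.diag v) 1 + wordExp l := by simp [wordExp]

@[simp] theorem wordExp_append (l l' : List Indet) :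
    wordExp (l ++ l') = wordExp l + wordExp l' := by simp [wordExp]

@[simp] theorem midExp_nil : midExp [] = 0 := rfl

@[simp] theorem midExp_cons (v : Indet) (l : List Indet) :
    midExp (v :: l) = Finsupp.single (.mid v.idx) 1 + midExp l := by simp [midExp]

@[simp] theorem wordSgn_nil : wordSgn [] = 1 := rfl

@[simp] theorem wordSgn_cons (v : Indet) (l : List Indet) :
    wordSgn (v :: l) = v.cls.sgn * wordSgn l := by simp [wordSgn]

@[simp] theorem wordSgn_append (l l' : List Indet) :
    wordSgn (l ++ l') = wordSgn l * wordSgn l' := by simp [wordSgn]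

theorem wordSgn_mul_self (l : List Indet) : wordSgn l * wordSgn l = 1 := by
  induction l with
  | nil => rfl
  | cons v l ih =>
    rw [wordSgn_cons, mul_mul_mul_comm, v.cls.sgn_mul_sgn, ih, one_mul]

theorem EvenWord.tail {v : Indet} {l : List Indet} (h : EvenWord (v :: l)) : EvenWord l :=
  fun w hw => h w (List.mem_cons_of_mem _ hw)

theorem EvenWord.append {l l' : List Indet} (h : EvenWord l) (h' : EvenWord l') :
    EvenWord (l ++ l') := by
  intro v hv
  rcases List.mem_append.mp hv with hv | hv
  exacts [h v hv, h' v hv]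

theorem commProd_wordExp {M : Type*} [Monoid M] {g : GenVar → M} (hg : ∀ s t, Commute (g s) (g t))
    (l : List Indet) : commProd g (wordExp l) = (l.map fun v => g (.diag v)).prod := by
  rw [wordExp, commProd_sum hg, List.map_map]
  congr 2
  funext v
  simp

theorem commProd_midExp {M : Type*} [Monoid M] {g : GenVar → M} (hg : ∀ s t, Commute (g s) (g t))
    (l : List Indet) : commProd g (midExp l) = (l.map fun v => g (.mid v.idx)).prod := by
  rw [midExp, commProd_sum hg, List.map_map]
  congr 2
  funext v
  simp

/-- The additive extension of `g` to exponents. -/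
noncomputable def linSum {σ M : Type*} [AddCommMonoid M] (g : σ → M) : (σ →₀ ℕ) →+ M :=
  (Finsupp.linearCombination ℕ g).toAddMonoidHom

@[simp]
theorem linSum_single {σ M : Type*} [AddCommMonoid M] (g : σ → M) (s : σ) :
    linSum g (Finsupp.single s 1) = g s := by simp [linSum]

theorem linSum_wordExp {M : Type*} [AddCommMonoid M] (g : GenVar → M) (l : List Indet)
    (hg : ∀ v ∈ l, g (.diag v) = 0) : linSum g (wordExp l) = 0 := by
  induction l with
  | nil => simp
  | cons v l ih =>
    rw [wordExp_cons, map_add, linSum_single, hg v (by simp),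
      ih fun w hw => hg w (List.mem_cons_of_mem _ hw), add_zero]

theorem linSum_midExp {M : Type*} [AddCommMonoid M] (g : GenVar → M) (l : List Indet)
    (hg : ∀ i, g (.mid i) = 0) : linSum g (midExp l) = 0 := by
  induction l with
  | nil => simp
  | cons v l ih => rw [midExp_cons, map_add, linSum_single, hg, ih, add_zero]

/-! ### The values of words in an algebra that satisfies the basis -/

section Values

variable {A : Type*} [Ring A]

/-- The factor `yᵢ⁺` for the variable `diag yᵢ⁺`. -/
def posFactor (a : Indet → A) : GenVar → A
  | .diag ⟨.Ypos, i⟩ => a ⟨.Ypos, i⟩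
  | _ => 1

/-- The factor `yᵢ⁻` for the variable `diag yᵢ⁻`. -/
def negFactor (a : Indet → A) : GenVar → A
  | .diag ⟨.Yneg, i⟩ => a ⟨.Yneg, i⟩
  | _ => 1

/-- The factor `yᵢ⁺` for the variable `mid i`. -/
def midFactor (a : Indet → A) : GenVar → A
  | .mid i => a ⟨.Ypos, i⟩
  | _ => 1

/-- The sign of the indeterminate `v` for the variable `diag v`. -/
def sgnFactor : GenVar → ℤ
  | .diag v => v.cls.sgn
  | _ => 1

/-- The summand `z` for the variable `diag z`, `z` odd. -/
def oddTerm (a : Indet → A) : GenVar → A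
  | .diag ⟨.Zpos, i⟩ => a ⟨.Zpos, i⟩
  | .diag ⟨.Zneg, i⟩ => a ⟨.Zneg, i⟩
  | _ => 0

/-- The summand `± z` for the variable `diag z`, `z` odd. -/
def oddSgnTerm (a : Indet → A) : GenVar → A
  | .diag ⟨.Zpos, i⟩ => a ⟨.Zpos, i⟩
  | .diag ⟨.Zneg, i⟩ => -a ⟨.Zneg, i⟩
  | _ => 0

/-- The product of the even letters of an exponent, the symmetric ones first. -/
noncomputable def evenProd (a : Indet → A) (m : GenVar →₀ ℕ) : A :=
  commProd (posFactor a) m * commProd (negFactor a) m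

theorem oddTerm_diag (a : Indet → A) {v : Indet} (hv : v.cls.deg = 1) :
    oddTerm a (.diag v) = a v := by
  obtain ⟨c, i⟩ := v
  cases c <;> simp_all [oddTerm, IndetClass.deg]

theorem oddSgnTerm_diag (a : Indet → A) {v : Indet} (hv : v.cls.deg = 1) :
    oddSgnTerm a (.diag v) = v.cls.sgn • a v := by
  obtain ⟨c, i⟩ := v
  cases c <;> simp_all [oddSgnTerm, IndetClass.deg, IndetClass.sgn]

theorem oddTerm_even (a : Indet → A) {v : Indet} (hv : v.cls.deg = 0) :
    oddTerm a (.diag v) = 0 := by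
  obtain ⟨c, i⟩ := v
  cases c <;> simp_all [oddTerm, IndetClass.deg]

theorem oddSgnTerm_even (a : Indet → A) {v : Indet} (hv : v.cls.deg = 0) :
    oddSgnTerm a (.diag v) = 0 := by
  obtain ⟨c, i⟩ := v
  cases c <;> simp_all [oddSgnTerm, IndetClass.deg]

/-- Even letters contribute nothing to the sum, so applying `linSum` to an exponent extracts its odd
letters. -/
theorem linSum_odd {g : GenVar → A} (hg : ∀ v : Indet, v.cls.deg = 0 →
    g (.diag v) = 0) {l : List Indet} (hl : EvenWord l) : linSum g (wordExp l) = 0 :=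
  linSum_wordExp _ _ fun v hv => hg v (hl v hv)

theorem commute_sgnFactor (s t : GenVar) : Commute (sgnFactor s) (sgnFactor t) :=
  Commute.all _ _

theorem commProd_sgnFactor_wordExp (l : List Indet) :
    commProd sgnFactor (wordExp l) = wordSgn l := by
  rw [commProd_wordExp commute_sgnFactor]
  rfl

theorem commProd_sgnFactor_midExp (l : List Indet) : commProd sgnFactor (midExp l) = 1 := by
  rw [commProd_midExp commute_sgnFactor]
  simp [sgnFactor]

variable {F : Type*} [Field F] [Algebra F A] {D : ZMod 2 → Submodule F A}
  [SetLike.GradedMonoid D] {τ : GradedInvolution D}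

omit [SetLike.GradedMonoid D] in
theorem GradedInvolution.map_one (τ : GradedInvolution D) : τ.toFun 1 = 1 := by
  have h := τ.anti_mul 1 (τ.toFun 1)
  rwa [one_mul, τ.involutive, one_mul, eq_comm] at h

theorem HasClass.one (τ : GradedInvolution D) : HasClass τ .Ypos 1 :=
  ⟨SetLike.GradedOne.one_mem, by simp [IndetClass.sgn, GradedInvolution.map_one]⟩

theorem even_mul_even {x y : A} (hx : x ∈ D 0) (hy : y ∈ D 0) : x * y ∈ D 0 := by
  simpa using SetLike.mul_mem_graded hx hy

theorem even_mul_odd {x y : A} (hx : x ∈ D 0) (hy : y ∈ D 1) : x * y ∈ D 1 := by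
  simpa using SetLike.mul_mem_graded hx hy

theorem odd_mul_even {x y : A} (hx : x ∈ D 1) (hy : y ∈ D 0) : x * y ∈ D 1 := by
  simpa using SetLike.mul_mem_graded hx hy

theorem EvenWord.prod_mem {a : Indet → A} (ha : ∀ v, HasClass τ v.cls (a v)) {l : List Indet}
    (hl : EvenWord l) : (l.map a).prod ∈ D 0 := by
  induction l with
  | nil => simpa using SetLike.GradedOne.one_mem
  | cons v l ih =>
    have := (ha v).1
    rw [hl v (by simp)] at this
    simpa using even_mul_even this (ih hl.tail)

section Memberships

variable {a : Indet → A} (ha : ∀ v, HasClass τ v.cls (a v))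
include ha

theorem posFactor_class (s : GenVar) : HasClass τ .Ypos (posFactor a s) := by
  rcases s with ⟨_ | _ | _ | _, i⟩ | i | i
  all_goals first | exact HasClass.one τ | exact ha ⟨.Ypos, i⟩

theorem midFactor_class (s : GenVar) : HasClass τ .Ypos (midFactor a s) := by
  rcases s with ⟨_ | _ | _ | _, i⟩ | i | i
  all_goals first | exact HasClass.one τ | exact ha ⟨.Ypos, i⟩

theorem negFactor_mem (m : GenVar →₀ ℕ) : commProd (negFactor a) m ∈ D 0 := by
  refine commProd_mem (P := (· ∈ D 0)) SetLike.GradedOne.one_mem (fun x y => even_mul_even) ?_ m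
  rintro (⟨_ | _ | _ | _, i⟩ | i | i)
  all_goals first | exact SetLike.GradedOne.one_mem | exact (ha ⟨.Yneg, i⟩).1

end Memberships

/-! ### Rearranging even words next to odd elements and commutators -/

namespace SatisfiesBasis

variable (h : SatisfiesBasis τ)
include h

/-- Symmetric even elements commute, so their products are again symmetric. A whole block of
symmetric letters can thus be substituted for one `y⁺` in the identities. -/
theorem pos_mul_pos {x y : A} (hx : HasClass τ .Ypos x) (hy : HasClass τ .Ypos y) :
    HasClass τ .Ypos (x * y) := by
  refine ⟨even_mul_even hx.1 hy.1, ?_⟩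
  rw [τ.anti_mul, hx.2, hy.2]
  simp only [IndetClass.sgn, one_smul]
  exact h.comm hy hx

variable {a : Indet → A} (ha : ∀ v, HasClass τ v.cls (a v))
include ha

theorem commute_posFactor (s t : GenVar) : Commute (posFactor a s) (posFactor a t) :=
  h.comm (posFactor_class ha s) (posFactor_class ha t)

theorem commute_midFactor (s t : GenVar) : Commute (midFactor a s) (midFactor a t) :=
  h.comm (midFactor_class ha s) (midFactor_class ha t)

omit [SetLike.GradedMonoid D] in
theorem commute_negFactor (s t : GenVar) : Commute (negFactor a s) (negFactor a t) := by
  rcases s with ⟨_ | _ | _ | _, i⟩ | i | i <;> rcases t with ⟨_ | _ | _ | _, j⟩ | j | j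
  all_goals first
    | exact Commute.one_left _
    | exact Commute.one_right _
    | exact h.comm (ha ⟨.Yneg, i⟩) (ha ⟨.Yneg, j⟩)

theorem posProd_class (m : GenVar →₀ ℕ) : HasClass τ .Ypos (commProd (posFactor a) m) :=
  commProd_mem (P := HasClass τ .Ypos) (HasClass.one τ) (fun _ _ => h.pos_mul_pos)
    (posFactor_class ha) m

theorem midProd_class (m : GenVar →₀ ℕ) : HasClass τ .Ypos (commProd (midFactor a) m) :=
  commProd_mem (P := HasClass τ .Ypos) (HasClass.one τ) (fun _ _ => h.pos_mul_pos)
    (midFactor_class ha) m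

theorem midProd_wordExp (l : List Indet) : commProd (midFactor a) (wordExp l) = 1 := by
  rw [commProd_wordExp (h.commute_midFactor ha)]
  simp [midFactor]

theorem posProd_midExp (l : List Indet) : commProd (posFactor a) (midExp l) = 1 := by
  rw [commProd_midExp (h.commute_posFactor ha)]
  simp [posFactor]

omit [SetLike.GradedMonoid D] in
theorem negProd_midExp (l : List Indet) : commProd (negFactor a) (midExp l) = 1 := by
  rw [commProd_midExp (h.commute_negFactor ha)]
  simp [negFactor]

theorem midProd_midExp {l : List Indet} (hl : ∀ v ∈ l, v.cls = .Ypos) :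
    commProd (midFactor a) (midExp l) = (l.map a).prod := by
  rw [commProd_midExp (h.commute_midFactor ha)]
  congr 1
  refine List.map_congr_left fun v hv => ?_
  obtain ⟨c, i⟩ := v
  obtain rfl : c = .Ypos := hl _ hv
  rfl

omit h ha in
/-- `t` is annihilated on the left by all the commutators of a symmetric and a skew even
element. -/
def Killed (τ : GradedInvolution D) (t : A) : Prop :=
  ∀ x y w, HasClass τ .Ypos x → HasClass τ .Yneg y → w ∈ D 0 → (x * y - y * x) * w * t = 0

/-- The letters of an even word commute with each other in front of a killed element. -/
theorem prod_mul_killed {l : List Indet} (hl : EvenWord l) {t : A} (ht : Killed τ t) :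
    (l.map a).prod * t = evenProd a (wordExp l) * t := by
  induction l with
  | nil => simp [evenProd]
  | cons v l ih =>
    obtain ⟨c, i⟩ := v
    have hv := hl _ List.mem_cons_self
    rw [List.map_cons, List.prod_cons, mul_assoc, ih hl.tail, wordExp_cons, evenProd, evenProd,
      commProd_add (h.commute_posFactor ha), commProd_add (h.commute_negFactor ha),
      commProd_single, commProd_single]
    cases c <;> simp only [IndetClass.deg, one_ne_zero] at hv
    · simp [posFactor, negFactor, mul_assoc]
    -- A skew letter at the front has to pass the symmetric product already collected. The error
    -- term is a commutator, times the collected skew product, times `t`, which vanishes.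
    · have := ht _ _ _ (h.posProd_class ha (wordExp l)) (ha ⟨.Yneg, i⟩)
        (negFactor_mem ha (wordExp l))
      rw [sub_mul, sub_mul, sub_eq_zero] at this
      simp only [posFactor, negFactor, one_mul]
      simp only [mul_assoc] at this ⊢
      exact this.symm

variable [CharZero F]

omit ha in
-- Together with `killed_commutator` this covers the two kinds of elements in front of which even
-- words are brought to normal form.
theorem killed_odd {t : A} (ht : t ∈ D 1) : Killed τ t := fun _ _ _ hx hy hw => by
  rw [mul_assoc]
  exact h.commutator_mul_odd hx hy (even_mul_odd hw ht)

omit ha in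
theorem killed_commutator {x y : A} (hx : HasClass τ .Ypos x) (hy : HasClass τ .Yneg y) :
    Killed τ (x * y - y * x) := fun _ _ _ hx' hy' hw =>
  h.commutator_mul_mul_commutator hx' hy' hw hx hy

/-- The mirror image of `prod_mul_killed` for odd elements, resting on `z[y⁺,y⁻] = 0`. The induction
absorbs the first letter into the odd factor, so `t` has to vary. -/
theorem odd_mul_prod {l : List Indet} (hl : EvenWord l) {t : A} (ht : t ∈ D 1) :
    t * (l.map a).prod = t * evenProd a (wordExp l) := by
  induction l generalizing t with
  | nil => simp [evenProd]
  | cons v l ih =>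
    obtain ⟨c, i⟩ := v
    have hv := hl _ List.mem_cons_self
    have hm : a ⟨c, i⟩ ∈ D 0 := hv ▸ (ha ⟨c, i⟩).1
    rw [List.map_cons, List.prod_cons, ← mul_assoc, ih hl.tail (odd_mul_even ht hm),
      wordExp_cons, evenProd, evenProd,
      commProd_add (h.commute_posFactor ha), commProd_add (h.commute_negFactor ha),
      commProd_single, commProd_single]
    cases c <;> simp only [IndetClass.deg, one_ne_zero] at hv
    · simp [posFactor, negFactor, mul_assoc]
    · have := h.odd_mul_commutator (h.posProd_class ha (wordExp l)) (ha ⟨.Yneg, i⟩) ht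
      rw [mul_sub, sub_eq_zero] at this
      simp only [posFactor, negFactor, one_mul]
      simp only [← mul_assoc] at this ⊢
      rw [this]

omit [SetLike.GradedMonoid D] h [CharZero F] in
/-- An even word moves across an element that commutes with the symmetric letters and anticommutes
with the skew ones, at the cost of its sign. -/
theorem mul_prod_eq {s : A} (hp : ∀ y, HasClass τ .Ypos y → s * y = y * s)
    (hn : ∀ y, HasClass τ .Yneg y → s * y = -(y * s)) {l : List Indet} (hl : EvenWord l) :
    s * (l.map a).prod = wordSgn l • ((l.map a).prod * s) := by
  induction l with
  | nil => simp
  | cons v l ih =>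
    obtain ⟨c, i⟩ := v
    have hv := hl _ List.mem_cons_self
    have := ih hl.tail
    rw [List.map_cons, List.prod_cons, wordSgn_cons, ← mul_assoc]
    cases c <;> simp only [IndetClass.deg, one_ne_zero] at hv
    · rw [hp _ (ha ⟨.Ypos, i⟩), mul_assoc, this, mul_smul_comm]
      simp [IndetClass.sgn, mul_assoc]
    · rw [hn _ (ha ⟨.Yneg, i⟩), neg_mul, mul_assoc, this, mul_smul_comm]
      simp [IndetClass.sgn, mul_assoc]

/-- An even word with a skew letter vanishes between two odd elements. -/
theorem odd_mul_prod_mul_odd {l : List Indet} (hl : EvenWord l) (hn : ∃ v ∈ l, v.cls = .Yneg)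
    {t t' : A} (ht : t ∈ D 1) (ht' : t' ∈ D 1) : t * (l.map a).prod * t' = 0 := by
  obtain ⟨v, hv, hc⟩ := hn
  obtain ⟨l₁, l₂, rfl⟩ := List.append_of_mem hv
  have h1 : EvenWord l₁ := fun w hw => hl w (by simp [hw])
  have h2 : EvenWord l₂ := fun w hw => hl w (by simp [hw])
  -- The letters around the skew one are absorbed into the two odd factors, which reduces the claim
  -- to identity 9.
  have := h.odd_mul_neg_mul_odd (odd_mul_even ht (h1.prod_mem ha)) (hc ▸ ha v)
    (even_mul_odd (h2.prod_mem ha) ht')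
  simpa [mul_assoc] using this

/-- An odd element vanishes between two even words with a skew letter. -/
theorem prod_mul_odd_mul_prod {l l' : List Indet} (hl : EvenWord l) (hl' : EvenWord l')
    (hn : ∃ v ∈ l, v.cls = .Yneg) (hn' : ∃ v ∈ l', v.cls = .Yneg) {t : A} (ht : t ∈ D 1) :
    (l.map a).prod * t * (l'.map a).prod = 0 := by
  obtain ⟨v, hv, hc⟩ := hn
  obtain ⟨l₁, l₂, rfl⟩ := List.append_of_mem hv
  obtain ⟨v', hv', hc'⟩ := hn'
  obtain ⟨l₃, l₄, rfl⟩ := List.append_of_mem hv'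
  have h2 : EvenWord l₂ := fun w hw => hl w (by simp [hw])
  have h3 : EvenWord l₃ := fun w hw => hl' w (by simp [hw])
  have := h.neg_mul_odd_mul_neg (hc ▸ ha v) (hc' ▸ ha v')
    (odd_mul_even (even_mul_odd (h2.prod_mem ha) ht) (h3.prod_mem ha))
  simp only [List.map_append, List.map_cons, List.prod_append, List.prod_cons]
  calc _ = (l₁.map a).prod * (a v * ((l₂.map a).prod * t * (l₃.map a).prod) * a v') *
        (l₄.map a).prod := by simp only [mul_assoc]
    _ = 0 := by rw [this]; simp

end SatisfiesBasis

end Values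

/-! ### The generic matrices -/

section Generic

open MvPolynomial

variable {R : Type*} [CommRing R]

/-- The generic element of a class of `UT_3`. -/
def genericMatrix (s : GenVar → R) : Indet → Matrix (Fin 3) (Fin 3) R
  | ⟨.Ypos, i⟩ => !![s (.diag ⟨.Ypos, i⟩), 0, s (.corner i); 0, s (.mid i), 0;
      0, 0, s (.diag ⟨.Ypos, i⟩)]
  | ⟨.Yneg, i⟩ => !![s (.diag ⟨.Yneg, i⟩), 0, 0; 0, 0, 0; 0, 0, -s (.diag ⟨.Yneg, i⟩)]
  | ⟨.Zpos, i⟩ => !![0, s (.diag ⟨.Zpos, i⟩), 0; 0, 0, s (.diag ⟨.Zpos, i⟩); 0, 0, 0]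
  | ⟨.Zneg, i⟩ => !![0, s (.diag ⟨.Zneg, i⟩), 0; 0, 0, -s (.diag ⟨.Zneg, i⟩); 0, 0, 0]

theorem genericMatrix_odd (s : GenVar → R) {v : Indet} (hv : v.cls.deg = 1) :
    genericMatrix s v =
      !![0, s (.diag v), 0; 0, 0, v.cls.sgn * s (.diag v); 0, 0, 0] := by
  obtain ⟨c, i⟩ := v
  cases c <;> simp_all [genericMatrix, IndetClass.deg, IndetClass.sgn]

variable (F : Type*) [Field F]

/-- The value of a word at the generic matrices. -/
noncomputable def genericWord (l : List Indet) : Matrix (Fin 3) (Fin 3) (MvPolynomial GenVar F) :=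
  (l.map (genericMatrix X)).prod

theorem genericWord_append (l l' : List Indet) :
    genericWord F (l ++ l') = genericWord F l * genericWord F l' := by simp [genericWord]

theorem genericWord_cons (v : Indet) (l : List Indet) :
    genericWord F (v :: l) = genericMatrix X v * genericWord F l := by simp [genericWord]

open Classical in
/-- The middle entry of the value of an even word at the generic matrices. -/
noncomputable def midPoly (l : List Indet) : MvPolynomial GenVar F :=
  if ∀ v ∈ l, v.cls = .Ypos then monomial (midExp l) 1 else 0

theorem midPoly_of_pos {l : List Indet} (hl : ∀ v ∈ l, v.cls = .Ypos) :
    midPoly F l = monomial (midExp l) 1 := if_pos hl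

theorem midPoly_of_neg {l : List Indet} (hl : ¬∀ v ∈ l, v.cls = .Ypos) :
    midPoly F l = 0 := if_neg hl

/-- The corner `C` is left unspecified: only its change under an exchange of adjacent letters is
needed, see `genericWord_swap`. -/
theorem genericWord_even {l : List Indet} (hl : EvenWord l) :
    ∃ C, genericWord F l = !![monomial (wordExp l) 1, 0, C; 0, midPoly F l, 0;
      0, 0, monomial (wordExp l) (wordSgn l : F)] := by
  induction l with
  | nil =>
    refine ⟨0, ?_⟩
    rw [midPoly_of_pos F (by simp)]
    simp [genericWord, Matrix.one_fin_three]
  | cons v l ih =>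
    obtain ⟨C, ih⟩ := ih hl.tail
    obtain ⟨c, i⟩ := v
    have hv := hl _ List.mem_cons_self
    rw [genericWord_cons, ih]
    cases c <;> simp only [IndetClass.deg, one_ne_zero] at hv
    · have : midPoly F (⟨.Ypos, i⟩ :: l) = X (.mid i) * midPoly F l := by
        by_cases h : ∀ v ∈ l, v.cls = .Ypos
        · rw [midPoly_of_pos F h, midPoly_of_pos F (by simpa using h), midExp_cons, X,
            monomial_mul, one_mul]
        · rw [midPoly_of_neg F h, midPoly_of_neg F (by simpa using h), mul_zero]
      refine ⟨X (.diag ⟨.Ypos, i⟩) * C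
        + X (.corner i) * monomial (wordExp l) (wordSgn l : F), ?_⟩
      rw [genericMatrix, Matrix.mul_fin_three, this]
      simp [X, monomial_mul, IndetClass.sgn]
    · refine ⟨X (.diag ⟨.Yneg, i⟩) * C, ?_⟩
      rw [genericMatrix, Matrix.mul_fin_three,
        midPoly_of_neg F
        (l := ⟨.Yneg, i⟩ :: l) fun h => by simpa using h _ List.mem_cons_self]
      simp [X, monomial_mul, IndetClass.sgn]

theorem sgn_mul_X_mul_monomial (k r : ℤ) (s : GenVar) (m : GenVar →₀ ℕ) :
    (k : MvPolynomial GenVar F) * X s * monomial m (r : F) =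
      monomial (Finsupp.single s 1 + m) (k * r : F) := by
  have : (k : MvPolynomial GenVar F) = monomial 0 (k : F) := by
    rw [← C_apply, map_intCast]
  rw [this, X, monomial_mul, monomial_mul, zero_add, mul_one]

/-- A word with exactly one odd letter at the generic matrices. -/
theorem genericWord_odd {u v : List Indet} {z : Indet} (hu : EvenWord u) (hv : EvenWord v)
    (hz : z.cls.deg = 1) :
    genericWord F (u ++ z :: v) =
      !![0, monomial (wordExp u + Finsupp.single (.diag z) 1) 1 * midPoly F v, 0;
        0, 0, midPoly F u * monomial (Finsupp.single (.diag z) 1 + wordExp v)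
          (z.cls.sgn * wordSgn v : F);
        0, 0, 0] := by
  obtain ⟨C, hC⟩ := genericWord_even F hu
  obtain ⟨C', hC'⟩ := genericWord_even F hv
  rw [genericWord_append, genericWord_cons, hC, hC', genericMatrix_odd _ hz, ← mul_assoc,
    Matrix.mul_fin_three, Matrix.mul_fin_three, ← sgn_mul_X_mul_monomial]
  simp [X, monomial_mul, mul_assoc]

/-- A word with exactly two odd letters at the generic matrices. -/
theorem genericWord_odd_odd {u v w : List Indet} {z z' : Indet} (hu : EvenWord u)
    (hv : EvenWord v) (hw : EvenWord w) (hz : z.cls.deg = 1) (hz' : z'.cls.deg = 1) :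
    genericWord F (u ++ z :: (v ++ z' :: w)) =
      !![0, 0, monomial (wordExp u + Finsupp.single (.diag z) 1) 1 * midPoly F v *
        monomial (Finsupp.single (.diag z') 1 + wordExp w) (z'.cls.sgn * wordSgn w : F);
        0, 0, 0; 0, 0, 0] := by
  obtain ⟨C, hC⟩ := genericWord_even F hw
  have : u ++ z :: (v ++ z' :: w) = (u ++ z :: v) ++ z' :: w := by simp
  rw [this, genericWord_append, genericWord_cons, genericWord_odd F hu hv hz, hC,
    genericMatrix_odd _ hz', ← mul_assoc, Matrix.mul_fin_three, Matrix.mul_fin_three,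
    ← sgn_mul_X_mul_monomial F z'.cls.sgn (wordSgn w)]
  simp [mul_assoc]

theorem genericWord_odd_odd_odd {u v w l : List Indet} {z z' z'' : Indet} (hu : EvenWord u)
    (hv : EvenWord v) (hw : EvenWord w) (hz : z.cls.deg = 1) (hz' : z'.cls.deg = 1)
    (hz'' : z''.cls.deg = 1) :
    genericWord F (u ++ z :: (v ++ z' :: (w ++ z'' :: l))) = 0 := by
  have : u ++ z :: (v ++ z' :: (w ++ z'' :: l)) = (u ++ z :: (v ++ z' :: w)) ++ z'' :: l := by
    simp
  rw [this, genericWord_append, genericWord_cons, genericWord_odd_odd F hu hv hw hz hz',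
    genericMatrix_odd _ hz'', ← mul_assoc, Matrix.mul_fin_three]
  have h0 : (!![0, 0, 0; 0, 0, 0; 0, 0, 0] : Matrix (Fin 3) (Fin 3) (MvPolynomial GenVar F)) = 0 :=
    by ext i j; fin_cases i <;> fin_cases j <;> rfl
  simp [h0]

theorem genericMatrix_comm (s : GenVar → R) (c : IndetClass) (hc : c.deg = 0) (i j : ℕ) :
    genericMatrix s ⟨c, i⟩ * genericMatrix s ⟨c, j⟩ =
      genericMatrix s ⟨c, j⟩ * genericMatrix s ⟨c, i⟩ := by
  cases c <;> simp only [IndetClass.deg, one_ne_zero] at hc <;>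
    simp only [genericMatrix, Matrix.mul_fin_three] <;> ext a b <;>
    fin_cases a <;> fin_cases b <;> simp <;> ring

/-- The effect of the exchange of two adjacent letters on the corner of an even word. -/
theorem genericWord_swap {u v : List Indet} (hu : EvenWord u) (hv : EvenWord v) (i j : ℕ) :
    genericWord F (u ++ ⟨.Ypos, i⟩ :: ⟨.Yneg, j⟩ :: v) 0 2 -
      genericWord F (u ++ ⟨.Yneg, j⟩ :: ⟨.Ypos, i⟩ :: v) 0 2 =
    monomial (wordExp (u ++ v) + Finsupp.single (.corner i) 1 +
      Finsupp.single (.diag ⟨.Yneg, j⟩) 1) (-2 * (wordSgn v : F)) := by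
  obtain ⟨C, hC⟩ := genericWord_even F hu
  obtain ⟨C', hC'⟩ := genericWord_even F hv
  -- The commutator of the generic `y⁺` and `y⁻` is `-2 · corner · diag · e₁₃`. The word `u` acts on
  -- it through its `(1,1)` entry and `v` through its `(3,3)` entry, the source of the sign of `v`.
  have : (monomial (wordExp (u ++ v) + Finsupp.single (.corner i) 1 +
      Finsupp.single (.diag ⟨.Yneg, j⟩) 1) (-2 * (wordSgn v : F)) : MvPolynomial GenVar F) =
      monomial (wordExp u) 1 * (X (.corner i)) * X (.diag ⟨.Yneg, j⟩) *
        monomial (wordExp v) (wordSgn v : F) * (-2) := by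
    have h2 : (-2 : MvPolynomial GenVar F) = monomial 0 (-2) := by
      rw [← C_apply, C_neg]; rfl
    rw [h2]
    simp only [X, monomial_mul, wordExp_append]
    refine congrArg₂ (fun m r => monomial m r) ?_ ?_
    · rw [add_zero]; abel
    · ring
  rw [this]
  simp only [genericWord_append, genericWord_cons, hC, hC', genericMatrix, Matrix.mul_fin_three]
  simp
  ring

end Generic

/-! ### Recovering the value of a word from its value at the generic matrices -/

section ExpSum

open MvPolynomial

variable {F A σ : Type*} [Field F] [Ring A] [Algebra F A]

/-- The linear map on polynomials with prescribed values on the monomials. -/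
noncomputable def expSum (φ : (σ →₀ ℕ) → A) : MvPolynomial σ F →ₗ[F] A :=
  (basisMonomials σ F).constr F φ

theorem expSum_monomial (φ : (σ →₀ ℕ) → A) (m : σ →₀ ℕ) (r : F) :
    expSum φ (monomial m r) = r • φ m := by
  have : (monomial m r : MvPolynomial σ F) = r • basisMonomials σ F m := by
    simp [smul_monomial]
  rw [this, map_smul, expSum, Module.Basis.constr_basis]

end ExpSum

theorem wordExp_apply (l : List Indet) (v : Indet) : wordExp l (.diag v) = l.count v := by
  induction l with
  | nil => simp
  | cons w l ih =>
    rw [wordExp_cons, Finsupp.add_apply, ih, List.count_cons, add_comm]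
    classical simp [Finsupp.single_apply]

theorem midExp_apply (l : List Indet) (v : Indet) : midExp l (.diag v) = 0 := by
  induction l with
  | nil => simp
  | cons w l ih => simp [ih]

theorem perm_of_wordExp_eq {l l' : List Indet} (h : wordExp l = wordExp l') : l.Perm l' :=
  List.perm_iff_count.mpr fun v => by rw [← wordExp_apply, h, wordExp_apply]

/-- A function on even words that is invariant under adjacent exchanges is invariant under
permutations. -/
theorem eq_of_perm_of_swap {B : Type*} {f : List Indet → B}
    (hf : ∀ u x y v, EvenWord (u ++ x :: y :: v) → f (u ++ x :: y :: v) = f (u ++ y :: x :: v))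
    {l l' : List Indet} (h : l.Perm l') (hl : EvenWord l) : f l = f l' := by
  -- An arbitrary prefix is carried along; it absorbs the common head of the two lists in the `cons`
  -- case.
  suffices ∀ u, EvenWord (u ++ l) → f (u ++ l) = f (u ++ l') from this [] hl
  clear hl
  induction h with
  | nil => intros; rfl
  | cons x h ih => intro u hu; simpa using ih (u ++ [x]) (by simpa using hu)
  | swap x y l => intro u hu; exact hf u y x l hu
  | trans h h' ih ih' =>
    intro u hu
    rw [ih u hu, ih' u fun v hv => hu v ((h.append_left u).mem_iff.mpr hv)]

theorem evenWord_or_exists_odd (l : List Indet) :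
    EvenWord l ∨ ∃ u z v, EvenWord u ∧ z.cls.deg = 1 ∧ l = u ++ z :: v := by
  induction l with
  | nil => exact Or.inl fun v hv => by simp at hv
  | cons x l ih =>
    have hx : x.cls.deg = 0 ∨ x.cls.deg = 1 := by
      obtain ⟨c, i⟩ := x
      cases c <;> simp [IndetClass.deg]
    rcases hx with hx | hx
    · rcases ih with ih | ⟨u, z, v, hu, hz, rfl⟩
      · refine Or.inl fun v hv => ?_
        rcases List.mem_cons.mp hv with rfl | hv
        exacts [hx, ih v hv]
      · refine Or.inr ⟨x :: u, z, v, fun w hw => ?_, hz, rfl⟩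
        rcases List.mem_cons.mp hw with rfl | hw
        exacts [hx, hu w hw]
    · exact Or.inr ⟨[], x, l, fun v hv => by simp at hv, hx, rfl⟩

theorem EvenWord.exists_neg {l : List Indet} (hl : EvenWord l) (h : ¬∀ v ∈ l, v.cls = .Ypos) :
    ∃ v ∈ l, v.cls = .Yneg := by
  push Not at h
  obtain ⟨⟨c, i⟩, hv, hc⟩ := h
  have := hl _ hv
  refine ⟨_, hv, ?_⟩
  cases c <;> simp_all [IndetClass.deg]

section Recovery

variable {F A : Type*} [Field F] [Ring A] [Algebra F A]

open Classical in
/-- The value of the products `y⁻ ⋯ y⁻ [yᵢ⁺, yⱼ⁻]` with the skew letters `m`. -/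
noncomputable def skewPart (a : Indet → A) (i : ℕ) (m : GenVar →₀ ℕ) : A :=
  if h : ∃ j, m (.diag ⟨.Yneg, j⟩) ≠ 0 then
    commProd (negFactor a) (m - Finsupp.single (.diag ⟨.Yneg, h.choose⟩) 1) *
      (a ⟨.Ypos, i⟩ * a ⟨.Yneg, h.choose⟩ - a ⟨.Yneg, h.choose⟩ * a ⟨.Ypos, i⟩)
  else 0

/-- The summand `skewPart a i m` for the variable `corner i`. -/
noncomputable def cornerTerm (a : Indet → A) (m : GenVar →₀ ℕ) : GenVar → A
  | .corner i => skewPart a i m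
  | _ => 0

/-- The value of a monomial in the `(1,2)` entry. -/
noncomputable def recover01 (a : Indet → A) (m : GenVar →₀ ℕ) : A :=
  evenProd a m * linSum (oddTerm a) m * commProd (midFactor a) m

open Classical in
/-- The value of a monomial in the `(2,3)` entry; the monomials of words without skew even letters
are left to the `(1,2)` entry. -/
noncomputable def recover12 (a : Indet → A) (m : GenVar →₀ ℕ) : A :=
  if ∃ i, m (.diag ⟨.Yneg, i⟩) ≠ 0 then
    commProd sgnFactor m • (commProd (midFactor a) m * linSum (oddTerm a) m * evenProd a m)
  else 0

/-- The product of the two odd letters of an exponent with the `mid` letters between them, up to the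
sign of the second one. -/
noncomputable def oddPair (F : Type*) [Field F] [Algebra F A] (a : Indet → A)
    (m : GenVar →₀ ℕ) : A :=
  (2⁻¹ : F) • (linSum (oddTerm a) m * commProd (midFactor a) m * linSum (oddSgnTerm a) m -
    linSum (fun s => oddTerm a s * commProd (midFactor a) m * oddSgnTerm a s) m)

/-- The value of a monomial in the `(1,3)` entry. -/
noncomputable def recover02 (F : Type*) [Field F] [Algebra F A] (a : Indet → A)
    (m : GenVar →₀ ℕ) : A :=
  -- The first term vanishes on exponents without odd letters, the second on exponents without
  -- `corner` variables, so two-odd-letter words and even words do not interfere. The factor `-2⁻¹`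
  -- inverts the `-2` of `genericWord_swap`.
  evenProd a m * oddPair F a m -
    (2⁻¹ : F) • (commProd (posFactor a) m * linSum (cornerTerm a m) m)

/-- The part of the value of a word that is not recovered from the `(1,3)` entry. -/
noncomputable def residue (F : Type*) [Field F] [Algebra F A] (a : Indet → A)
    (l : List Indet) : A :=
  (l.map a).prod - expSum (recover02 F a) (genericWord F l 0 2)

/-- The value of a monomial in the `(1,1)` entry. -/
noncomputable def recover00 (F : Type*) [Field F] [Algebra F A] (a : Indet → A) :
    (GenVar →₀ ℕ) → A :=
  -- Many even words share an exponent. The extension takes the intended value because the residue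
  -- depends only on the exponent, by `residue_swap`; exponents not arising from even words get the
  -- value `0`.
  Function.extend (fun l : {l : List Indet // EvenWord l} => wordExp l.1)
    (fun l => residue F a l.1) 0

/-- The linear map that recovers the value of a word from its value at the generic matrices. -/
noncomputable def recover (F : Type*) [Field F] [Algebra F A] (a : Indet → A) :
    Matrix (Fin 3) (Fin 3) (MvPolynomial GenVar F) →ₗ[F] A :=
  expSum (recover00 F a) ∘ₗ Matrix.entryLinearMap F _ 0 0 +
    expSum (recover01 a) ∘ₗ Matrix.entryLinearMap F _ 0 1 +
    expSum (recover12 a) ∘ₗ Matrix.entryLinearMap F _ 1 2 +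
    expSum (recover02 F a) ∘ₗ Matrix.entryLinearMap F _ 0 2

theorem recover_apply (a : Indet → A) (M : Matrix (Fin 3) (Fin 3) (MvPolynomial GenVar F)) :
    recover F a M = expSum (recover00 F a) (M 0 0) + expSum (recover01 a) (M 0 1) +
      expSum (recover12 a) (M 1 2) + expSum (recover02 F a) (M 0 2) := rfl

theorem posFactor_odd (a : Indet → A) {z : Indet} (hz : z.cls.deg = 1) :
    posFactor a (.diag z) = 1 := by
  obtain ⟨c, i⟩ := z
  cases c <;> simp_all [posFactor, IndetClass.deg]

theorem negFactor_odd (a : Indet → A) {z : Indet} (hz : z.cls.deg = 1) :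
    negFactor a (.diag z) = 1 := by
  obtain ⟨c, i⟩ := z
  cases c <;> simp_all [negFactor, IndetClass.deg]

/-! ### Recovery of words with no, one or two odd letters -/

namespace SatisfiesBasis

variable {D : ZMod 2 → Submodule F A} {τ : GradedInvolution D}
  (h : SatisfiesBasis τ) {a : Indet → A} (ha : ∀ v, HasClass τ v.cls (a v))
include h ha

/-- The skew letter chosen in the definition of `skewPart` is immaterial: by
`neg_mul_commutator_swap`, the one inside the commutator may be traded for any of those in front of
it. -/
theorem skewPart_add (i j : ℕ) (m : GenVar →₀ ℕ) :
    skewPart a i (m + Finsupp.single (.diag ⟨.Yneg, j⟩) 1) = commProd (negFactor a) m *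
      (a ⟨.Ypos, i⟩ * a ⟨.Yneg, j⟩ - a ⟨.Yneg, j⟩ * a ⟨.Ypos, i⟩) := by
  have hex : ∃ k, (m + Finsupp.single (GenVar.diag ⟨.Yneg, j⟩) 1 : GenVar →₀ ℕ) (.diag ⟨.Yneg, k⟩) ≠ 0 :=
    ⟨j, by simp⟩
  rw [skewPart, dif_pos hex]
  have hk := hex.choose_spec
  generalize hex.choose = k at hk ⊢
  by_cases hjk : k = j
  · subst hjk
    rw [add_tsub_cancel_right]
  · have hk' : m (.diag ⟨.Yneg, k⟩) ≠ 0 := by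
      simpa [Finsupp.single_apply, Ne.symm hjk] using hk
    obtain ⟨n, rfl⟩ : ∃ n, m = n + Finsupp.single (GenVar.diag ⟨.Yneg, k⟩) 1 :=
      ⟨_, (tsub_add_cancel_of_le (Finsupp.single_le_iff.mpr (Nat.one_le_iff_ne_zero.mpr hk'))).symm⟩
    rw [add_right_comm, add_tsub_cancel_right, commProd_add (h.commute_negFactor ha),
      commProd_add (h.commute_negFactor ha), commProd_single, commProd_single, mul_assoc, mul_assoc]
    congr 1
    exact h.neg_mul_commutator_swap (ha ⟨.Ypos, i⟩) (ha ⟨.Yneg, j⟩) (ha ⟨.Yneg, k⟩)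

variable [SetLike.GradedMonoid D]

omit [SetLike.GradedMonoid D] in
theorem negProd_wordExp_corner (l : List Indet) (i : ℕ) :
    commProd (negFactor a) (wordExp l + Finsupp.single (.corner i) 1) =
      commProd (negFactor a) (wordExp l) := by
  rw [commProd_add (h.commute_negFactor ha), commProd_single]
  simp [negFactor]

/-- Evaluates the recovery map on the monomial by which the corners of two even words differ after
an adjacent exchange. -/
theorem recover02_corner {l : List Indet} (hl : EvenWord l) (i j : ℕ) :
    recover02 F a (wordExp l + Finsupp.single (.corner i) 1 +
      Finsupp.single (.diag ⟨.Yneg, j⟩) 1) = (-2⁻¹ : F) • (evenProd a (wordExp l) *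
        (a ⟨.Ypos, i⟩ * a ⟨.Yneg, j⟩ - a ⟨.Yneg, j⟩ * a ⟨.Ypos, i⟩)) := by
  set m := wordExp l + Finsupp.single (GenVar.corner i) 1 +
    Finsupp.single (.diag ⟨.Yneg, j⟩) 1 with hm
  have h1 : ∀ g : GenVar → A, (∀ v : Indet, v.cls.deg = 0 → g (.diag v) = 0) →
      linSum g m = g (.corner i) := by
    intro g hg
    rw [hm, map_add, map_add, linSum_odd hg hl, linSum_single, linSum_single, hg _ rfl, zero_add,
      add_zero]
  have h2 : oddPair F a m = 0 := by
    rw [oddPair, h1 _ fun v => oddTerm_even a, h1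
      (fun s => oddTerm a s * commProd (midFactor a) m * oddSgnTerm a s)
      fun v hv => by simp [oddTerm_even a hv]]
    simp [show oddTerm a (.corner i) = 0 from rfl]
  rw [recover02, h2, h1 _ fun _ _ => rfl, mul_zero, zero_sub, ← neg_smul, cornerTerm, hm,
    h.skewPart_add ha, h.negProd_wordExp_corner ha, commProd_add (h.commute_posFactor ha),
    commProd_add (h.commute_posFactor ha), commProd_single, commProd_single]
  simp [posFactor, evenProd, mul_assoc]

variable [CharZero F]

theorem residue_swap (u : List Indet) (x y : Indet) (v : List Indet)
    (hl : EvenWord (u ++ x :: y :: v)) :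
    residue F a (u ++ x :: y :: v) = residue F a (u ++ y :: x :: v) := by
  have hu : EvenWord u := fun w hw => hl w (by simp [hw])
  have hv : EvenWord v := fun w hw => hl w (by simp [hw])
  -- The value changes by `u[y⁺,y⁻]v`. The commutator is symmetric and even, and anticommutes with
  -- skew even elements, so `v` moves to its left with the sign of `v`; the letters of `uv` then
  -- commute in front of it. The recovered part changes by the same element, as `(-2)·(-2⁻¹) = 1`.
  have key : ∀ i j, residue F a (u ++ ⟨.Ypos, i⟩ :: ⟨.Yneg, j⟩ :: v) =
      residue F a (u ++ ⟨.Yneg, j⟩ :: ⟨.Ypos, i⟩ :: v) := by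
    intro i j
    have h1 := HasClass.commutator_even (ha ⟨.Ypos, i⟩) (ha ⟨.Yneg, j⟩)
    have h2 := mul_prod_eq ha (fun y hy => h.comm h1 hy)
      (fun y hy => h.commutator_mul_neg (ha ⟨.Ypos, i⟩) (ha ⟨.Yneg, j⟩) hy) hv
    have h3 := h.prod_mul_killed ha (hu.append hv)
      (h.killed_commutator (ha ⟨.Ypos, i⟩) (ha ⟨.Yneg, j⟩))
    have h4 : (-2 * (wordSgn v : F) * -2⁻¹) = wordSgn v := by field_simp
    rw [residue, residue, sub_eq_sub_iff_sub_eq_sub, ← map_sub, genericWord_swap F hu hv,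
      expSum_monomial, h.recover02_corner ha (hu.append hv), ← h3, smul_smul, h4, Int.cast_smul_eq_zsmul,
      List.map_append (l₁ := u) (l₂ := v), List.prod_append, mul_assoc (u.map a).prod, ← mul_smul_comm, ← h2]
    simp [mul_sub, sub_mul, mul_assoc]
  have key' : ∀ c : IndetClass, c.deg = 0 → ∀ i j, residue F a (u ++ ⟨c, i⟩ :: ⟨c, j⟩ :: v) =
      residue F a (u ++ ⟨c, j⟩ :: ⟨c, i⟩ :: v) := by
    intro c hc i j
    have h1 := h.comm (ha ⟨c, i⟩) (ha ⟨c, j⟩)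
    rw [residue, residue]
    congr 1
    · simp only [List.map_append, List.map_cons, List.prod_append, List.prod_cons]
      rw [← mul_assoc (a ⟨c, i⟩), h1, mul_assoc]
    · simp only [genericWord_append, genericWord_cons]
      rw [← mul_assoc (genericMatrix _ ⟨c, i⟩), genericMatrix_comm _ c hc, mul_assoc]
  have hx := hl x (by simp)
  have hy := hl y (by simp)
  obtain ⟨c, i⟩ := x
  obtain ⟨d, j⟩ := y
  cases c <;> simp only [IndetClass.deg, one_ne_zero] at hx <;>
    cases d <;> simp only [IndetClass.deg, one_ne_zero] at hy
  · exact key' _ rfl _ _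
  · exact key _ _
  · exact (key _ _).symm
  · exact key' _ rfl _ _

/-- The residue is assigned to the `(1,1)` monomial and the rest of the value comes from the corner,
so the two add up by the definition of `residue`. -/
theorem recover_even {l : List Indet} (hl : EvenWord l) :
    recover F a (genericWord F l) = (l.map a).prod := by
  obtain ⟨C, hC⟩ := genericWord_even F hl
  have hfac : Function.FactorsThrough (fun l : {l : List Indet // EvenWord l} => residue F a l.1)
      (fun l => wordExp l.1) := fun l l' hll =>
    eq_of_perm_of_swap (h.residue_swap ha) (perm_of_wordExp_eq hll) l.2
  have h1 : recover00 F a (wordExp l) = residue F a l := hfac.extend_apply 0 ⟨l, hl⟩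
  have e0 : genericWord F l 0 0 = MvPolynomial.monomial (wordExp l) 1 := by rw [hC]; rfl
  have e1 : genericWord F l 0 1 = 0 := by rw [hC]; rfl
  have e2 : genericWord F l 1 2 = 0 := by rw [hC]; rfl
  rw [recover_apply, e0, e1, e2, expSum_monomial, h1, residue]
  simp

omit [CharZero F] in
theorem evenProd_odd_mid (u v : List Indet) {z : Indet} (hz : z.cls.deg = 1) :
    evenProd a (wordExp u + Finsupp.single (.diag z) 1 + midExp v) = evenProd a (wordExp u) := by
  simp only [evenProd, commProd_add (h.commute_posFactor ha), commProd_add (h.commute_negFactor ha),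
    commProd_single, h.posProd_midExp ha, h.negProd_midExp ha, posFactor_odd a hz,
    negFactor_odd a hz, mul_one]

omit [CharZero F] in
theorem midProd_odd_mid (u v : List Indet) (z : Indet) :
    commProd (midFactor a) (wordExp u + Finsupp.single (.diag z) 1 + midExp v) =
      commProd (midFactor a) (midExp v) := by
  simp [commProd_add (h.commute_midFactor ha), h.midProd_wordExp ha, midFactor]

omit h ha [SetLike.GradedMonoid D] [CharZero F] in
theorem linSum_odd_mid {u : List Indet} (hu : EvenWord u) (v : List Indet) (z : Indet)
    {g : GenVar → A} (hg : ∀ v : Indet, v.cls.deg = 0 → g (.diag v) = 0)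
    (hg' : ∀ i, g (.mid i) = 0) :
    linSum g (wordExp u + Finsupp.single (.diag z) 1 + midExp v) = g (.diag z) := by
  rw [map_add, map_add, linSum_odd hg hu, linSum_midExp _ _ hg', linSum_single, zero_add, add_zero]

/-- If no skew letter follows `z`, the `(1,2)` entry yields the value, and `recover12` contributes
nothing, so that words in `Y⁺` and `z` alone are not counted twice. If skew letters occur only after
`z`, the `(1,2)` entry is zero and the `(2,3)` entry is used. With skew letters on both sides, both
entries and the value vanish. -/
theorem recover_odd {u v : List Indet} {z : Indet} (hu : EvenWord u) (hv : EvenWord v)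
    (hz : z.cls.deg = 1) :
    recover F a (genericWord F (u ++ z :: v)) = ((u ++ z :: v).map a).prod := by
  have hzm : a z ∈ D 1 := hz ▸ (ha z).1
  have hW : ((u ++ z :: v).map a).prod = (u.map a).prod * a z * (v.map a).prod := by
    simp [mul_assoc]
  have hcond : ∀ i, (midExp u + (Finsupp.single (GenVar.diag z) 1 + wordExp v) : GenVar →₀ ℕ)
      (.diag ⟨.Yneg, i⟩) = v.count ⟨.Yneg, i⟩ := by
    intro i
    have : z ≠ ⟨.Yneg, i⟩ := by rintro rfl; simp [IndetClass.deg] at hz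
    simp [midExp_apply, wordExp_apply, this]
  have e1 : genericWord F (u ++ z :: v) 0 1 =
      MvPolynomial.monomial (wordExp u + Finsupp.single (.diag z) 1) 1 * midPoly F v := by
    rw [genericWord_odd F hu hv hz]; rfl
  have e2 : genericWord F (u ++ z :: v) 1 2 = midPoly F u * MvPolynomial.monomial
      (Finsupp.single (.diag z) 1 + wordExp v) (z.cls.sgn * wordSgn v : F) := by
    rw [genericWord_odd F hu hv hz]; rfl
  have e0 : genericWord F (u ++ z :: v) 0 0 = 0 := by rw [genericWord_odd F hu hv hz]; rfl
  have e3 : genericWord F (u ++ z :: v) 0 2 = 0 := by rw [genericWord_odd F hu hv hz]; rfl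
  rw [recover_apply, e0, e1, e2, e3, hW, map_zero, map_zero, zero_add, add_zero]
  by_cases hvp : ∀ w ∈ v, w.cls = .Ypos
  · have h2 : expSum (recover12 a) (midPoly F u * MvPolynomial.monomial
      (Finsupp.single (.diag z) 1 + wordExp v) (z.cls.sgn * wordSgn v : F)) = 0 := by
      by_cases hup : ∀ w ∈ u, w.cls = .Ypos
      · rw [midPoly_of_pos F hup, MvPolynomial.monomial_mul, expSum_monomial, recover12, if_neg,
          smul_zero]
        rintro ⟨i, hi⟩
        rw [hcond, ← Nat.pos_iff_ne_zero, List.count_pos_iff] at hi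
        simpa using hvp _ hi
      · rw [midPoly_of_neg F hup, zero_mul, map_zero]
    rw [h2, add_zero, midPoly_of_pos F hvp, MvPolynomial.monomial_mul, expSum_monomial, recover01,
      h.evenProd_odd_mid ha u v hz, h.midProd_odd_mid ha, h.midProd_midExp ha hvp,
      linSum_odd_mid hu v z (fun v => oddTerm_even a) (fun i => rfl), oddTerm_diag a hz,
      h.prod_mul_killed ha hu (h.killed_odd hzm), mul_one, one_smul]
  · obtain ⟨w, hw, hwc⟩ := hv.exists_neg hvp
    rw [midPoly_of_neg F hvp, mul_zero, map_zero, zero_add]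
    by_cases hup : ∀ w ∈ u, w.cls = .Ypos
    · have hex : ∃ i, (midExp u + (Finsupp.single (GenVar.diag z) 1 + wordExp v) : GenVar →₀ ℕ)
          (.diag ⟨.Yneg, i⟩) ≠ 0 := by
        obtain ⟨c, i⟩ := w
        obtain rfl : c = .Yneg := hwc
        exact ⟨i, by rw [hcond]; exact (List.count_pos_iff.mpr hw).ne'⟩
      have s1 : commProd sgnFactor (midExp u + (Finsupp.single (GenVar.diag z) 1 + wordExp v)) =
          z.cls.sgn * wordSgn v := by
        rw [commProd_add commute_sgnFactor, commProd_add commute_sgnFactor,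
          commProd_sgnFactor_midExp, commProd_sgnFactor_wordExp, commProd_single, one_mul]
        rfl
      -- The sign in the entry can be read off from its exponent, so `recover12` multiplies by it
      -- once more and it cancels.
      have s2 : (z.cls.sgn * wordSgn v) * (z.cls.sgn * wordSgn v) = 1 := by
        rw [mul_mul_mul_comm, z.cls.sgn_mul_sgn, wordSgn_mul_self, one_mul]
      have s3 : midExp u + (Finsupp.single (GenVar.diag z) 1 + wordExp v) =
          wordExp v + Finsupp.single (.diag z) 1 + midExp u := by abel
      rw [midPoly_of_pos F hup, MvPolynomial.monomial_mul, expSum_monomial, recover12, if_pos hex,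
        s1, one_mul, ← Int.cast_mul, Int.cast_smul_eq_zsmul, smul_smul, s2, one_smul, s3,
        h.evenProd_odd_mid ha v u hz, h.midProd_odd_mid ha, h.midProd_midExp ha hup,
        linSum_odd_mid hv u z (fun v => oddTerm_even a) (fun i => rfl), oddTerm_diag a hz,
        mul_assoc, mul_assoc, h.odd_mul_prod ha hv hzm]
    · rw [midPoly_of_neg F hup, zero_mul, map_zero, h.prod_mul_odd_mul_prod ha hu hv
        (hu.exists_neg hup) ⟨w, hw, hwc⟩ hzm]

/-- The exponent forgets the order of the two odd letters. Polarization leaves half the sum of both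
orders, each with the sign of its second letter, and `odd_mul_pos_mul_odd` says that these two
signed products agree. -/
theorem oddPair_eq {u v : List Indet} {z z' : Indet} (hu : EvenWord u) (hz : z.cls.deg = 1)
    (hz' : z'.cls.deg = 1) {m : GenVar →₀ ℕ} (hm : m = wordExp u + Finsupp.single (.diag z) 1 +
      midExp v + Finsupp.single (.diag z') 1) :
    oddPair F a m = z'.cls.sgn • (a z * commProd (midFactor a) (midExp v) * a z') := by
  have h1 : ∀ g : GenVar → A, (∀ v : Indet, v.cls.deg = 0 → g (.diag v) = 0) →
      (∀ i, g (.mid i) = 0) → linSum g m = g (.diag z) + g (.diag z') := by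
    intro g hg hg'
    rw [hm, map_add, linSum_odd_mid hu v z hg hg', linSum_single]
  have h2 : commProd (midFactor a) m = commProd (midFactor a) (midExp v) := by
    rw [hm, commProd_add (h.commute_midFactor ha), h.midProd_odd_mid ha, commProd_single]
    simp [midFactor]
  have h3 := h.odd_mul_pos_mul_odd hz hz' (ha z) (ha z') (h.midProd_class ha (midExp v))
  rw [oddPair, h1 _ (fun v => oddTerm_even a) (fun _ => rfl),
    h1 _ (fun v => oddSgnTerm_even a) (fun _ => rfl),
    h1 _ (fun v hv => by simp [oddTerm_even a hv]) (fun _ => by simp [oddTerm]), h2,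
    oddTerm_diag a hz, oddTerm_diag a hz', oddSgnTerm_diag a hz, oddSgnTerm_diag a hz']
  simp only [add_mul, mul_add, mul_smul_comm, smul_add, h3]
  rw [inv_smul_eq_iff₀ two_ne_zero, two_smul]
  abel

theorem recover_odd_odd {u v w : List Indet} {z z' : Indet} (hu : EvenWord u) (hv : EvenWord v)
    (hw : EvenWord w) (hz : z.cls.deg = 1) (hz' : z'.cls.deg = 1) :
    recover F a (genericWord F (u ++ z :: (v ++ z' :: w))) =
      ((u ++ z :: (v ++ z' :: w)).map a).prod := by
  have hzm : a z ∈ D 1 := hz ▸ (ha z).1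
  have hzm' : a z' ∈ D 1 := hz' ▸ (ha z').1
  have hvm := hv.prod_mem ha
  have hW : ((u ++ z :: (v ++ z' :: w)).map a).prod =
      (u.map a).prod * (a z * (v.map a).prod * a z' * (w.map a).prod) := by
    simp [mul_assoc]
  have hE := genericWord_odd_odd F hu hv hw hz hz'
  have e0 : genericWord F (u ++ z :: (v ++ z' :: w)) 0 0 = 0 := by rw [hE]; rfl
  have e1 : genericWord F (u ++ z :: (v ++ z' :: w)) 0 1 = 0 := by rw [hE]; rfl
  have e2 : genericWord F (u ++ z :: (v ++ z' :: w)) 1 2 = 0 := by rw [hE]; rfl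
  have e3 : genericWord F (u ++ z :: (v ++ z' :: w)) 0 2 =
      MvPolynomial.monomial (wordExp u + Finsupp.single (.diag z) 1) 1 * midPoly F v *
        MvPolynomial.monomial (Finsupp.single (.diag z') 1 + wordExp w)
          (z'.cls.sgn * wordSgn w : F) := by rw [hE]; rfl
  rw [recover_apply, e0, e1, e2, e3, hW, map_zero, map_zero, map_zero, zero_add, zero_add, zero_add]
  by_cases hvp : ∀ w ∈ v, w.cls = .Ypos
  · set m := wordExp (u ++ w) + Finsupp.single (GenVar.diag z) 1 + midExp v +
      Finsupp.single (.diag z') 1 with hm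
    have hm' : wordExp u + Finsupp.single (GenVar.diag z) 1 + midExp v +
        (Finsupp.single (.diag z') 1 + wordExp w) = m := by
      rw [hm, wordExp_append]; abel
    have h1 : linSum (cornerTerm a m) m = 0 := by
      rw [hm, map_add, linSum_odd_mid (hu.append hw) v z (fun _ _ => rfl) (fun _ => rfl),
        linSum_single]
      exact add_zero _
    have h2 : evenProd a m = evenProd a (wordExp (u ++ w)) := by
      rw [← h.evenProd_odd_mid ha (u ++ w) v hz, hm, evenProd, evenProd,
        commProd_add (h.commute_posFactor ha), commProd_add (h.commute_negFactor ha),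
        commProd_single, commProd_single, posFactor_odd a hz', negFactor_odd a hz', mul_one, mul_one]
    have hzv := odd_mul_even hzm hvm
    -- By identities 5 and 11 the block `z v z'` commutes with symmetric and anticommutes with skew
    -- even letters, so `w` passes to its left with the sign of `w`.
    have h3 := mul_prod_eq ha (s := a z * (v.map a).prod * a z')
      (fun y hy => (h.pos_comm_odd_mul_odd hy hzv hzm').symm)
      (fun y hy => h.odd_mul_odd_mul_neg hzv hzm' hy) hw
    have h4 := h.prod_mul_killed ha (hu.append hw) (h.killed_odd hzv)
    have s2 : (z'.cls.sgn * wordSgn w) * z'.cls.sgn = wordSgn w := by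
      rw [mul_right_comm, z'.cls.sgn_mul_sgn, one_mul]
    rw [midPoly_of_pos F hvp, MvPolynomial.monomial_mul, MvPolynomial.monomial_mul, hm',
      expSum_monomial, recover02, h1, h2, h.oddPair_eq ha (hu.append hw) hz hz' hm,
      h.midProd_midExp ha hvp, mul_zero, smul_zero, sub_zero, h3, mul_smul_comm, mul_smul_comm,
      ← mul_assoc (evenProd a _), ← h4, one_mul, one_mul, ← Int.cast_mul, Int.cast_smul_eq_zsmul,
      smul_smul, s2]
    simp [mul_assoc]
  · rw [midPoly_of_neg F hvp, mul_zero, zero_mul, map_zero,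
      h.odd_mul_prod_mul_odd ha hv (hv.exists_neg hvp) hzm hzm', zero_mul, mul_zero]

/-- The value of a word is recovered from its value at the generic matrices. -/
theorem recover_genericWord (l : List Indet) :
    recover F a (genericWord F l) = (l.map a).prod := by
  rcases evenWord_or_exists_odd l with hl | ⟨u, z, l, hu, hz, rfl⟩
  · exact h.recover_even ha hl
  rcases evenWord_or_exists_odd l with hl | ⟨v, z', l, hv, hz', rfl⟩
  · exact h.recover_odd ha hu hl hz
  rcases evenWord_or_exists_odd l with hl | ⟨w, z'', l, hw, hz'', rfl⟩
  · exact h.recover_odd_odd ha hu hv hl hz hz'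
  have hzm : a z ∈ D 1 := hz ▸ (ha z).1
  have hzm' : a z' ∈ D 1 := hz' ▸ (ha z').1
  have hzm'' : a z'' ∈ D 1 := hz'' ▸ (ha z'').1
  -- With the even words between them absorbed, the first three odd letters give a product of three
  -- odd elements, which is zero.
  have h0 := h.odd_mul_odd_mul_odd (odd_mul_even hzm (hv.prod_mem ha))
    (odd_mul_even hzm' (hw.prod_mem ha)) hzm''
  rw [genericWord_odd_odd_odd F hu hv hw hz hz' hz'', map_zero]
  calc (0 : A) = (u.map a).prod * (a z * (v.map a).prod * (a z' * (w.map a).prod) * a z'') *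
        (l.map a).prod := by rw [h0]; simp
    _ = _ := by simp [mul_assoc]

end SatisfiesBasis

end Recovery

/-! ### Substitutions -/

section Substitution

variable {F A : Type*} [Field F] [Ring A] [Algebra F A] {D : ZMod 2 → Submodule F A}
  [SetLike.GradedMonoid D]

/-- An admissible substitution is a homomorphism of graded algebras with graded involution. -/
theorem lift_isGradedInvHom {τ : GradedInvolution D} {a : Indet → A}
    (ha : ∀ v, HasClass τ v.cls (a v)) :
    IsGradedInvHom (freeInvolution F) τ (FreeAlgebra.lift F a) where
  map_mem g f hf := by
    induction hf using Submodule.span_induction with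
    | mem x hx =>
      obtain ⟨l, rfl, rfl⟩ := hx
      induction l with
      | nil => simpa [word, wordDeg] using SetLike.GradedOne.one_mem
      | cons v l ih =>
        have h1 : word F (v :: l) = FreeAlgebra.ι F v * word F l := by simp [word]
        have h2 : wordDeg (v :: l) = v.cls.deg + wordDeg l := by simp [wordDeg]
        rw [h1, h2, map_mul, FreeAlgebra.lift_ι_apply]
        exact SetLike.mul_mem_graded (ha v).1 ih
    | zero => simp
    | add x y _ _ hx hy => rw [map_add]; exact add_mem hx hy
    | smul c x _ hx => rw [map_smul]; exact Submodule.smul_mem _ c hx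
  map_inv f := by
    change FreeAlgebra.lift F a (freeInv F f) = _
    induction f using FreeAlgebra.induction with
    | grade0 r =>
      rw [freeInv_algebraMap, AlgHom.commutes, Algebra.algebraMap_eq_smul_one, map_smul,
        GradedInvolution.map_one]
    | grade1 v => rw [freeInv_ι, map_zsmul, FreeAlgebra.lift_ι_apply, (ha v).2]
    | mul f g hf hg => rw [freeInv_mul, map_mul, hf, hg, map_mul, τ.anti_mul]
    | add f g hf hg => rw [map_add, map_add, hf, hg, map_add, map_add]

theorem span_word (F : Type*) [Field F] (f : FreeYZ F) :
    f ∈ Submodule.span F (Set.range (word F)) := by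
  induction f using FreeAlgebra.induction with
  | grade0 r =>
    rw [Algebra.algebraMap_eq_smul_one]
    exact Submodule.smul_mem _ _ (Submodule.subset_span ⟨[], by simp [word]⟩)
  | grade1 v => exact Submodule.subset_span ⟨[v], by simp [word]⟩
  | mul f g hf hg =>
    have h := Submodule.mul_mem_mul hf hg
    rw [Submodule.span_mul_span] at h
    refine Submodule.span_mono ?_ h
    rintro _ ⟨_, ⟨l, rfl⟩, _, ⟨l', rfl⟩, rfl⟩
    exact ⟨l ++ l', by simp [word]⟩
  | add f g hf hg => exact add_mem hf hg

/-- Linear maps on the free algebra that agree on words are equal. -/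
theorem linearMap_ext_word {M : Type*} [AddCommMonoid M] [Module F M] {φ ψ : FreeYZ F →ₗ[F] M}
    (h : ∀ l, φ (word F l) = ψ (word F l)) : φ = ψ := by
  refine LinearMap.ext fun f => ?_
  exact LinearMap.eqOn_span (s := Set.range (word F)) (by rintro _ ⟨l, rfl⟩; exact h l)
    (span_word F f)

theorem lift_word {B : Type*} [Ring B] [Algebra F B] (a : Indet → B) (l : List Indet) :
    FreeAlgebra.lift F a (word F l) = (l.map a).prod := by
  rw [word, map_list_prod, List.map_map]
  congr 2
  funext v
  simp

variable [CharZero F]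

/-- Polynomials that vanish at the generic matrices vanish on every algebra that satisfies the
basis. -/
theorem SatisfiesBasis.lift_eq_zero {τ : GradedInvolution D} (h : SatisfiesBasis τ) {a : Indet → A}
    (ha : ∀ v, HasClass τ v.cls (a v)) {f : FreeYZ F}
    (hf : FreeAlgebra.lift F (genericMatrix (R := MvPolynomial GenVar F) MvPolynomial.X) f = 0) :
    FreeAlgebra.lift F a f = 0 := by
  have key : (FreeAlgebra.lift F a).toLinearMap = recover F a ∘ₗ (FreeAlgebra.lift F
      (genericMatrix (R := MvPolynomial GenVar F) MvPolynomial.X)).toLinearMap := by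
    refine linearMap_ext_word fun l => ?_
    have := h.recover_genericWord ha l
    simpa [lift_word, genericWord] using this.symm
  have := LinearMap.congr_fun key f
  simpa [hf] using this

end Substitution

/-! ### The identities of the upper triangular matrices -/

section UpperTriangular

variable {F : Type*} [Field F]

open Matrix

theorem hasClass_reflection_iff {c : IndetClass} {M : UT F 3} :
    HasClass (reflectionInvolution F) c M ↔
      (∀ i j, tuple010 i - tuple010 j ≠ c.deg → M.1 i j = 0) ∧
        ∀ i j : Fin 3, M.1 j.rev i.rev = c.sgn • M.1 i j := by
  refine and_congr Iff.rfl ⟨fun h i j => ?_, fun h => Subtype.ext (Matrix.ext fun i j => ?_)⟩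
  · have := congrArg (fun N : UT F 3 => N.1 i j) h
    exact this.trans (by cases c <;> simp [IndetClass.sgn])
  · exact (h i j).trans (by cases c <;> simp [IndetClass.sgn])

variable [CharZero F]

/-- The elements of each class are the values of the generic matrix of this class. -/
theorem HasClass.exists_generic {c : IndetClass} {M : UT F 3}
    (h : HasClass (reflectionInvolution F) c M) (i : ℕ) :
    ∃ s : GenVar → F, M.1 = genericMatrix s ⟨c, i⟩ := by
  obtain ⟨h1, h2⟩ := hasClass_reflection_iff.mp h
  have l10 : M.1 1 0 = 0 := M.2 (by decide)
  have l20 : M.1 2 0 = 0 := M.2 (by decide)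
  have l21 : M.1 2 1 = 0 := M.2 (by decide)
  have e00 := h2 0 0
  have e01 := h2 0 1
  have e11 := h2 1 1
  have e02 := h2 0 2
  have r0 : (0 : Fin 3).rev = 2 := rfl
  have r1 : (1 : Fin 3).rev = 1 := rfl
  have r2 : (2 : Fin 3).rev = 0 := rfl
  simp only [r0, r1, r2] at e00 e01 e11 e02
  cases c
  all_goals simp only [IndetClass.deg, IndetClass.sgn, one_smul, neg_smul] at h1 e00 e01 e11 e02
  · have g01 := h1 0 1 (by decide)
    have g12 := h1 1 2 (by decide)
    -- Only one matrix has to be matched, so the values may ignore the indices.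
    refine ⟨fun | .diag _ => M.1 0 0 | .mid _ => M.1 1 1 | .corner _ => M.1 0 2, ?_⟩
    ext i j; fin_cases i <;> fin_cases j <;> simp [genericMatrix, l10, l20, l21, g01, g12, e00]
  · have g01 := h1 0 1 (by decide)
    have g12 := h1 1 2 (by decide)
    have g11 := self_eq_neg.mp e11
    have g02 := self_eq_neg.mp e02
    refine ⟨fun _ => M.1 0 0, ?_⟩
    ext i j; fin_cases i <;> fin_cases j <;> simp [genericMatrix, l10, l20, l21, g01, g12, g11, g02, e00]
  · have g00 := h1 0 0 (by decide)
    have g11 := h1 1 1 (by decide)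
    have g02 := h1 0 2 (by decide)
    rw [g00] at e00
    refine ⟨fun _ => M.1 0 1, ?_⟩
    ext i j; fin_cases i <;> fin_cases j <;> simp [genericMatrix, l10, l20, l21, g00, g11, g02, e00, e01]
  · have g00 := h1 0 0 (by decide)
    have g11 := h1 1 1 (by decide)
    have g02 := h1 0 2 (by decide)
    rw [g00, neg_zero] at e00
    refine ⟨fun _ => M.1 0 1, ?_⟩
    ext i j; fin_cases i <;> fin_cases j <;> simp [genericMatrix, l10, l20, l21, g00, g11, g02, e00, e01]

omit [CharZero F] in
theorem genericMatrix_mem (s : GenVar → F) (v : Indet) :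
    genericMatrix s v ∈ UT F 3 := by
  obtain ⟨c, k⟩ := v
  intro i j hij
  cases c <;> fin_cases i <;> fin_cases j <;> first | rfl | (exact absurd hij (by decide))

omit [CharZero F] in
theorem genericMatrix_hasClass (s : GenVar → F) (v : Indet) :
    HasClass (reflectionInvolution F) v.cls ⟨genericMatrix s v, genericMatrix_mem s v⟩ := by
  obtain ⟨c, k⟩ := v
  rw [hasClass_reflection_iff]
  constructor
  · intro i j hij
    replace hij : tuple010 i - tuple010 j ≠ c.deg := hij
    cases c <;> fin_cases i <;> fin_cases j <;> first | rfl | (exact absurd hij (by decide))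
  · intro i j
    cases c <;> fin_cases i <;> fin_cases j <;>
      simp [genericMatrix, IndetClass.sgn, Fin.rev]

/-- The identities of `UT_3(F)` vanish at the generic matrices. -/
theorem lift_genericMatrix_eq_zero {f : FreeYZ F}
    (hf : f ∈ gradedStarIdentities (elementaryGrading F tuple010) (reflectionInvolution F)) :
    FreeAlgebra.lift F (genericMatrix (R := MvPolynomial GenVar F) MvPolynomial.X) f = 0 := by
  have key : ∀ s : GenVar → F, ((MvPolynomial.aeval s).mapMatrix).comp (FreeAlgebra.lift F
      (genericMatrix (R := MvPolynomial GenVar F) MvPolynomial.X)) =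
      (UT F 3).val.comp (FreeAlgebra.lift F
        fun v => (⟨genericMatrix s v, genericMatrix_mem s v⟩ : UT F 3)) := by
    intro s
    ext v : 2
    obtain ⟨c, k⟩ := v
    ext i j
    cases c <;> fin_cases i <;> fin_cases j <;> simp [genericMatrix]
  ext1 i j
  -- A field of characteristic zero is infinite, so a polynomial vanishing at all its points is
  -- zero.
  refine MvPolynomial.funext fun s => ?_
  have h0 := hf _ (fun v => (genericMatrix_hasClass s v).1) fun v => (genericMatrix_hasClass s v).2
  have := congrFun (congrFun (DFunLike.congr_fun (key s) f) i) j
  simpa [h0, MvPolynomial.aeval_eq_eval] using this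

omit [CharZero F] in
/-- The classes other than `Y⁺` are one-dimensional. -/
theorem exists_genericMatrix_eq_smul {c : IndetClass} (hc : c ≠ .Ypos) :
    ∃ N : Matrix (Fin 3) (Fin 3) F, ∀ s i, ∃ r : F, genericMatrix s ⟨c, i⟩ = r • N := by
  refine ⟨genericMatrix 1 ⟨c, 0⟩, fun s i => ⟨s (.diag ⟨c, i⟩), ?_⟩⟩
  cases c <;> simp at hc <;> ext i j <;> fin_cases i <;> fin_cases j <;> simp [genericMatrix]

omit [CharZero F] in
-- A multiple of `e₁₃` only sees the bottom row of the second factor, and a commutator of upper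
-- triangular matrices has zero bottom row.
theorem single_mul_commutator (r : F) (M N : UT F 3) :
    !![0, 0, r; 0, 0, 0; 0, 0, 0] * (M.1 * N.1 - N.1 * M.1) = 0 := by
  have hM0 : M.1 2 0 = 0 := M.2 (by decide)
  have hM1 : M.1 2 1 = 0 := M.2 (by decide)
  have hN0 : N.1 2 0 = 0 := N.2 (by decide)
  have hN1 : N.1 2 1 = 0 := N.2 (by decide)
  have h : ∀ j, (M.1 * N.1 - N.1 * M.1) 2 j = 0 := by
    intro j
    rw [Matrix.sub_apply, mul_apply, mul_apply, Fin.sum_univ_three, Fin.sum_univ_three, hM0, hM1, hN0, hN1]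
    fin_cases j <;> simp [hM0, hM1, hN0, hN1, mul_comm]
  generalize M.1 * N.1 - N.1 * M.1 = K at h
  ext i j
  fin_cases i <;> simp [mul_apply, Fin.sum_univ_three, h]

/-- Two facts replace most computations: each of `Y⁻`, `Z⁺`, `Z⁻` takes its values in a line, and
`[y⁺,y⁻]` is always a multiple of `e₁₃`. -/
theorem satisfiesBasis_reflectionInvolution : SatisfiesBasis (reflectionInvolution F) := by
  intro f hf a ha
  choose s hs using fun v : Indet => (ha v).exists_generic v.idx
  have hodd : ∀ c i, c.deg = 1 → (a ⟨c, i⟩).1 = !![0, s ⟨c, i⟩ (.diag ⟨c, i⟩), 0;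
      0, 0, c.sgn * s ⟨c, i⟩ (.diag ⟨c, i⟩); 0, 0, 0] :=
    fun c i hc => (hs ⟨c, i⟩).trans (genericMatrix_odd _ hc)
  -- A product of two odd elements is a multiple of `e₁₃`, and the `(1,1)` and `(3,3)` entries of a
  -- symmetric even element coincide.
  have hpos : ∀ {c₁ c₂}, c₁.deg = 1 → c₂.deg = 1 →
      a ⟨.Ypos, 1⟩ * (a ⟨c₁, 1⟩ * a ⟨c₂, 2⟩) = a ⟨c₁, 1⟩ * a ⟨c₂, 2⟩ * a ⟨.Ypos, 1⟩ := by
    intro c₁ c₂ h₁ h₂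
    refine Subtype.ext ?_
    simp only [MulMemClass.coe_mul]
    rw [hodd c₁ 1 h₁, hodd c₂ 2 h₂, hs ⟨.Ypos, 1⟩, genericMatrix]
    simp only [mul_fin_three]
    ext i j; fin_cases i <;> fin_cases j <;> simp [mul_comm]
  have hcomm : ∀ i j, ∃ r, (a ⟨.Ypos, i⟩ * a ⟨.Yneg, j⟩ - a ⟨.Yneg, j⟩ * a ⟨.Ypos, i⟩).1 =
      !![0, 0, r; 0, 0, 0; 0, 0, 0] := by
    intro i j
    refine ⟨-2 * s ⟨.Ypos, i⟩ (.corner i) * s ⟨.Yneg, j⟩ (.diag ⟨.Yneg, j⟩), ?_⟩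
    simp only [AddSubgroupClass.coe_sub, MulMemClass.coe_mul, hs, genericMatrix, mul_fin_three]
    ext i j; fin_cases i <;> fin_cases j <;> simp <;> ring
  refine Subtype.ext ?_
  cases hf with
  | id1 c d hc =>
    simp only [indet, map_sub, map_mul, FreeAlgebra.lift_ι_apply, AddSubgroupClass.coe_sub,
      MulMemClass.coe_mul, hs, ZeroMemClass.coe_zero]
    obtain ⟨N, hN⟩ := exists_genericMatrix_eq_smul (F := F) (c := c) (by
      rcases hc with rfl | rfl | rfl <;> simp)
    obtain ⟨r, hr⟩ := hN (s ⟨c, 1⟩) 1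
    obtain ⟨r', hr'⟩ := hN (s ⟨c, 3⟩) 3
    rw [hr, hr']
    simp [smul_smul, mul_comm r]
  | id2 c₁ c₂ c₃ h₁ h₂ h₃ =>
    simp only [indet, map_mul, FreeAlgebra.lift_ι_apply,
      MulMemClass.coe_mul, ZeroMemClass.coe_zero]
    rw [hodd c₁ 1 h₁, hodd c₂ 2 h₂, hodd c₃ 3 h₃, mul_fin_three, mul_fin_three]
    ext i j; fin_cases i <;> fin_cases j <;> simp
  | id3 c =>
    simp only [indet, Ring.lie_def, map_sub, map_mul, FreeAlgebra.lift_ι_apply,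
      AddSubgroupClass.coe_sub, MulMemClass.coe_mul, hs, ZeroMemClass.coe_zero]
    by_cases hc : c = .Ypos
    · subst hc
      simp only [genericMatrix, mul_fin_three]
      ext i j; fin_cases i <;> fin_cases j <;> simp <;> ring
    · obtain ⟨N, hN⟩ := exists_genericMatrix_eq_smul (F := F) hc
      obtain ⟨r, hr⟩ := hN (s ⟨c, 1⟩) 1
      obtain ⟨r', hr'⟩ := hN (s ⟨c, 2⟩) 2
      rw [hr, hr']
      simp [smul_smul, mul_comm r]
  | id4 c d =>
    obtain ⟨r, hr⟩ := hcomm 1 2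
    simp only [indet, Ring.lie_def, map_sub, map_mul, FreeAlgebra.lift_ι_apply]
    rw [MulMemClass.coe_mul, hr]
    exact single_mul_commutator r _ _
  | id5 c₁ c₂ h₁ h₂ =>
    simp only [indet, Ring.lie_def, map_sub, map_mul, FreeAlgebra.lift_ι_apply]
    rw [hpos h₁ h₂, sub_self]
  | id6_left c h =>
    obtain ⟨r, hr⟩ := hcomm 1 2
    simp only [indet, Ring.lie_def, map_sub, map_mul, FreeAlgebra.lift_ι_apply]
    rw [MulMemClass.coe_mul, hr, hodd c 3 h, mul_fin_three]
    ext i j; fin_cases i <;> fin_cases j <;> simp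
  | id6_right c h =>
    obtain ⟨r, hr⟩ := hcomm 1 2
    simp only [indet, Ring.lie_def, map_sub, map_mul, FreeAlgebra.lift_ι_apply]
    rw [MulMemClass.coe_mul, hr, hodd c 3 h, mul_fin_three]
    ext i j; fin_cases i <;> fin_cases j <;> simp
  | id7 =>
    obtain ⟨r, hr⟩ := hcomm 1 2
    simp only [indet, Ring.lie_def, map_add, map_sub, map_mul, FreeAlgebra.lift_ι_apply]
    rw [AddMemClass.coe_add, MulMemClass.coe_mul, MulMemClass.coe_mul, hr, hs, genericMatrix,
      mul_fin_three, mul_fin_three]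
    ext i j; fin_cases i <;> fin_cases j <;> simp <;> ring
  | id8 c h =>
    simp only [indet, map_mul, FreeAlgebra.lift_ι_apply,
      MulMemClass.coe_mul, ZeroMemClass.coe_zero]
    rw [hodd c 1 h, hs ⟨.Yneg, 1⟩, hs ⟨.Yneg, 2⟩, genericMatrix, genericMatrix, mul_fin_three,
      mul_fin_three]
    ext i j; fin_cases i <;> fin_cases j <;> simp
  | id9 c₁ c₂ h₁ h₂ =>
    simp only [indet, map_mul, FreeAlgebra.lift_ι_apply,
      MulMemClass.coe_mul, ZeroMemClass.coe_zero]
    rw [hodd c₁ 1 h₁, hodd c₂ 2 h₂, hs ⟨.Yneg, 1⟩, genericMatrix, mul_fin_three, mul_fin_three]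
    ext i j; fin_cases i <;> fin_cases j <;> simp
  | id10 =>
    simp only [indet, map_add, map_mul, FreeAlgebra.lift_ι_apply, AddMemClass.coe_add,
      MulMemClass.coe_mul, ZeroMemClass.coe_zero, hs, genericMatrix, mul_fin_three]
    ext i j; fin_cases i <;> fin_cases j <;> simp <;> ring
  | id11 c₁ c₂ h₁ h₂ =>
    simp only [indet, map_add, map_mul, FreeAlgebra.lift_ι_apply, AddMemClass.coe_add,
      MulMemClass.coe_mul, ZeroMemClass.coe_zero]
    rw [hodd c₁ 1 h₁, hodd c₂ 2 h₂, hs ⟨.Yneg, 1⟩, genericMatrix]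
    simp only [mul_fin_three]
    ext i j; fin_cases i <;> fin_cases j <;> simp <;> ring
  | id12 c₁ c₂ h₁ h₂ =>
    simp only [indet, Ring.lie_def, map_sub, map_mul, FreeAlgebra.lift_ι_apply, sub_mul,
      mul_sub, ← mul_assoc, sub_add_sub_cancel']
    -- The terms `z₁yz₂` have cancelled: identity 12 is the commutator of `z₁z₂` with `y⁺`.
    rw [mul_assoc (a ⟨.Ypos, 1⟩), hpos h₁ h₂]
    simp

end UpperTriangular

/-! ### `T`-ideals -/

section TIdeals

variable {F : Type*} [Field F]

/-- The identities of an algebra form a `T`-ideal. -/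
theorem exists_isTIdeal_identities {A : Type*} [Ring A] [Algebra F A]
    (𝒜 : ZMod 2 → Submodule F A) [GradedAlgebra 𝒜] (τ : GradedInvolution 𝒜) :
    ∃ I : Ideal (FreeYZ F), IsTIdeal I ∧ (I : Set (FreeYZ F)) = gradedStarIdentities 𝒜 τ := by
  refine ⟨{ carrier := gradedStarIdentities 𝒜 τ
            add_mem' := fun hf hg a h h' => by rw [map_add, hf a h h', hg a h h', add_zero]
            zero_mem' := fun a _ _ => map_zero _
            smul_mem' := fun c f hf a h h' => by
              rw [smul_eq_mul, map_mul, hf a h h', mul_zero] }, ⟨⟨?_⟩, ?_, ?_⟩, rfl⟩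
  · exact fun {f} g hf a h h' => by rw [map_mul, hf a h h', zero_mul]
  · intro f hf a h h'
    rw [(lift_isGradedInvHom (τ := τ) fun v => ⟨h v, h' v⟩).map_inv, hf a h h', map_zero]
  · intro φ hφ f hf a h h'
    have ha := lift_isGradedInvHom (τ := τ) (a := a) fun v => ⟨h v, h' v⟩
    -- Following an endomorphism of the free `(ℤ/2,⋆)`-algebra by an admissible substitution gives
    -- another admissible substitution.
    have key : (FreeAlgebra.lift F a).comp φ =
        FreeAlgebra.lift F fun v => FreeAlgebra.lift F a (φ (FreeAlgebra.ι F v)) := by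
      ext v; simp
    refine (DFunLike.congr_fun key f).trans (hf _ (fun v => ?_) fun v => ?_)
    · exact ha.map_mem _ _ (hφ.map_mem _ _ (ι_mem_freeGrading F v))
    · rw [← ha.map_inv, ← hφ.map_inv]
      change FreeAlgebra.lift F a (φ (freeInv F _)) = _
      rw [freeInv_ι, map_zsmul, map_zsmul]

/-! ### Quotients of the free algebra by T-ideals -/

variable {A : Type*} [Ring A] [Algebra F A]

/-- The image of the grading of the free algebra. -/
def imageGrading (π : FreeYZ F →ₐ[F] A) (d : ZMod 2) : Submodule F A :=
  (freeGrading F d).map π.toLinearMap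

/-- Multiplicativity of the components suffices for the recovery argument; it does not require their
sum to be direct. -/
instance (π : FreeYZ F →ₐ[F] A) : SetLike.GradedMonoid (imageGrading π) where
  one_mem := ⟨1, SetLike.GradedOne.one_mem, map_one π⟩
  mul_mem := by
    rintro i j _ _ ⟨f, hf, rfl⟩ ⟨g, hg, rfl⟩
    exact ⟨f * g, SetLike.mul_mem_graded hf hg, map_mul π f g⟩

/-- The involution of the free algebra descends to its quotients by invariant ideals. -/
theorem exists_imageInvolution {π : FreeYZ F →ₐ[F] A} (hπ : Function.Surjective π)
    (hinv : ∀ f, π f = 0 → π (freeInv F f) = 0) :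
    ∃ τ : GradedInvolution (imageGrading π), ∀ f, τ.toFun (π f) = π (freeInv F f) := by
  -- The involution is defined through a linear section `s`; invariance of the kernel makes the
  -- result independent of the section.
  obtain ⟨s, hs⟩ := LinearMap.exists_rightInverse_of_surjective π.toLinearMap
    (LinearMap.range_eq_top.mpr hπ)
  have hs' : ∀ x, π (s x) = x := fun x => LinearMap.congr_fun hs x
  have key : ∀ f, (π.toLinearMap ∘ₗ freeInv F ∘ₗ s) (π f) = π (freeInv F f) := by
    intro f
    have := hinv (s (π f) - f) (by rw [map_sub, hs', sub_self])
    rwa [map_sub, map_sub, sub_eq_zero] at this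
  refine ⟨⟨π.toLinearMap ∘ₗ freeInv F ∘ₗ s, fun x => ?_, fun x y => ?_, fun d x hx => ?_⟩, key⟩
  · obtain ⟨f, rfl⟩ := hπ x
    rw [key, key, freeInv_freeInv]
  · obtain ⟨f, rfl⟩ := hπ x
    obtain ⟨g, rfl⟩ := hπ y
    rw [← map_mul, key, key, key, freeInv_mul, map_mul]
  · obtain ⟨f, hf, rfl⟩ := hx
    exact ⟨freeInv F f, (freeInvolution F).graded d f hf, (key f).symm⟩

variable [CharZero F]

/-- The elements of a class of a quotient of the free algebra lift to elements of the class. -/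
theorem HasClass.exists_lift {π : FreeYZ F →ₐ[F] A} {τ : GradedInvolution (imageGrading π)}
    (hτ : ∀ f, τ.toFun (π f) = π (freeInv F f)) {c : IndetClass} {x : A} (hx : HasClass τ c x) :
    ∃ f, HasClass (freeInvolution F) c f ∧ π f = x := by
  obtain ⟨⟨f, hf, rfl⟩, hx⟩ := hx
  change τ.toFun (π f) = c.sgn • π f at hx
  -- Any homogeneous preimage is projected onto its symmetric or skew part; the image is unchanged
  -- since it already has that symmetry.
  refine ⟨(2⁻¹ : F) • (f + c.sgn • freeInv F f), ⟨Submodule.smul_mem _ _ (add_mem hf (zsmul_mem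
    ((freeInvolution F).graded _ _ hf) _)), ?_⟩, ?_⟩
  · change freeInv F _ = _
    rw [map_smul, map_add, map_zsmul, freeInv_freeInv, smul_comm c.sgn, smul_add c.sgn, smul_smul,
      c.sgn_mul_sgn, one_smul, add_comm]
  · change _ = π f
    rw [map_smul, map_add, map_zsmul, ← hτ, hx, smul_smul, c.sgn_mul_sgn, one_smul, ← two_smul F,
      smul_smul, inv_mul_cancel₀ two_ne_zero, one_smul]

/-- The quotient of the free algebra by a `T`-ideal that contains the basis satisfies it. -/
theorem IsTIdeal.satisfiesBasis {I : Ideal (FreeYZ F)} (hI : IsTIdeal I)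
    (hP : {f : FreeYZ F | IsBasisPoly F f} ⊆ I) {π : FreeYZ F →ₐ[F] A}
    (hπ : ∀ f, π f = 0 ↔ f ∈ I) {τ : GradedInvolution (imageGrading π)}
    (hτ : ∀ f, τ.toFun (π f) = π (freeInv F f)) : SatisfiesBasis τ := by
  intro p hp a ha
  -- Lifting the substituted elements within their classes gives an endomorphism of the free
  -- algebra. It maps the basis polynomial into the T-ideal, so the value in the quotient is zero.
  choose f hf hfa using fun v => (ha v).exists_lift hτ
  have key : FreeAlgebra.lift F a = π.comp (FreeAlgebra.lift F f) := by
    ext v; simp [hfa]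
  rw [key]
  exact (hπ _).mpr (hI.map_mem _ (lift_isGradedInvHom hf) _ (hP hp))

/-- A `T`-ideal that contains the basis contains the identities of `UT_3(F)`. -/
theorem IsTIdeal.identities_subset {I : Ideal (FreeYZ F)} (hI : IsTIdeal I)
    (hP : {f : FreeYZ F | IsBasisPoly F f} ⊆ I) :
    gradedStarIdentities (elementaryGrading F tuple010) (reflectionInvolution F) ⊆ I := by
  intro f hf
  have := hI.twoSided
  let π := Ideal.Quotient.mkₐ F I
  have hπ : ∀ f, π f = 0 ↔ f ∈ I := fun f => Ideal.Quotient.eq_zero_iff_mem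
  obtain ⟨τ, hτ⟩ := exists_imageInvolution (π := π) Ideal.Quotient.mk_surjective
    fun f hf => (hπ _).mpr (hI.inv_mem f ((hπ f).mp hf))
  -- The substitution is the tautological one, which sends every polynomial to its own class in the
  -- quotient.
  have ha : ∀ v : Indet, HasClass τ v.cls (π (FreeAlgebra.ι F v)) := fun v =>
    ⟨⟨_, ι_mem_freeGrading F v, rfl⟩, by rw [hτ, freeInv_ι, map_zsmul]⟩
  have h0 := (hI.satisfiesBasis hP hπ hτ).lift_eq_zero ha (lift_genericMatrix_eq_zero hf)
  have key : FreeAlgebra.lift F (fun v => π (FreeAlgebra.ι F v)) = π := by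
    ext v; simp
  rw [key] at h0
  exact (hπ f).mp h0

end TIdeals

theorem mainTheorem5 (F : Type*) [Field F] [CharZero F] :
    IsIdentityBasis {f : FreeYZ F | IsBasisPoly F f}
      (gradedStarIdentities (elementaryGrading F tuple010) (reflectionInvolution F)) := by
  -- The identities of `UT_3` are themselves one of the intersected ideals, and each of these ideals
  -- contains them.
  refine Set.Subset.antisymm (Set.sInter_subset_of_mem ?_) (Set.subset_sInter ?_)
  · obtain ⟨I, hI, h⟩ := exists_isTIdeal_identities (elementaryGrading F tuple010)
      (reflectionInvolution F)
    refine ⟨I, hI, ?_, h.symm⟩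
    rw [h]
    exact fun f hf a h h' => satisfiesBasis_reflectionInvolution f hf a fun v => ⟨h v, h' v⟩
  · rintro _ ⟨I, hI, hP, rfl⟩
    exact hI.identities_subset hP
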